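/- Let $F_{14}$ be the cubic graph with vertices $A,A',B,B',1,\dots,8$ and edges $AA'$, $BB'$, $A1$, $A5$, $A'3$, $A'7$, $B2$, $B6$, $B'4$, $B'8$, $12$, $23$, $34$, $45$, $56$, $67$, $78$, $81$. For a graph $G$, a graph $G\cup e$ is obtained from $G$ in one of three ways (loops and parallel edges are allowed in the result): - subdivide an edge of $G$ once by a new vertex $u$, and add a new vertex $v$, an edge $uv$ and a loop at $v$; - subdivide an edge of $G$ twice by new vertices $u,v$, and add a further edge $uv$; - subdivide two distinct edges $e_1,e_2$ of $G$ once each, by new vertices $u$ and $v$ respectively, and add the edge $uv$; this choice is denoted $e_1-e_2$. An embedding of a graph into a surface maps vertices to distinct points and edges to curves joining the images of their ends, such that the curves are simple and contain images of vertices only at their ends, and distinct curves meet only in images of vertices (the curve of a loop is a simple closed curve). A graph is toroidal if it embeds into the torus $T^2$. A face of an embedding is a connected component of the complement of its image. Then: 1. For every choice of $e$, the graph $F_{14}\cup e$ is toroidal. 2. Up to automorphisms of $F_{14}$ there are at most twelve choices of $e$ for which $F_{14}\cup e$ has girth at least four: every such choice is carried by an automorphism of $F_{14}$ to one of $AA'-BB'$,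 $AA'-B2$, $AA'-12$, $A1-A'3$, $A1-B2$, $A1-B6$, $A1-23$, $A1-34$, $A1-45$, $12-34$, $12-45$, $12-56$. 3. There is an embedding $\varphi$ of $F_{14}$ into $T^2$ with a face whose boundary is (the image of) an 8-cycle of $F_{14}$, such that for each of the twelve choices $e_1-e_2$ in part 2 there is an automorphism $\sigma$ of $F_{14}$ for which $\varphi$ extends to an embedding of $F_{14}\cup e$ with $e=\sigma(e_1)-\sigma(e_2)$ into $T^2$ (that is, the vertices of $F_{14}$ keep their images, and the image of each subdivided edge is the union of the images of its two halves). -/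

import Mathlib

namespace Graph

variable {α β : Type*}

/-- A cycle of length `n` in a multigraph: `n` distinct vertices and `n` distinct edges in cyclic
order. A loop is a cycle of length one, two parallel edges form a cycle of length two. -/
structure IsCycleOn (G : Graph α β) (n : ℕ) (v : ZMod n → α) (e : ZMod n → β) : Prop where
  pos : 0 < n
  vertex_injective : Function.Injective v
  edge_injective : Function.Injective e
  isLink : ∀ i, G.IsLink (e i) (v i) (v (i + 1))

/-- The girth: the length of a shortest cycle (`⊤` if there is no cycle). -/
noncomputable def girth (G : Graph α β) : ℕ∞ :=
  sInf {N : ℕ∞ | ∃ (n : ℕ) (v : ZMod n → α) (e : ZMod n → β), G.IsCycleOn n v e ∧ N = n}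

/-- An embedding of a multigraph into a topological space: vertices are distinct points, an edge is
a curve joining the images of its ends, the interior of this curve is simple, contains no vertex,
and is disjoint from the interior of the curve of any other edge. -/
structure SpaceEmbedding (G : Graph α β) (X : Type*) [TopologicalSpace X] where
  vert : α → X
  arc : β → C(unitInterval, X)
  vert_injOn : Set.InjOn vert G.vertexSet
  arc_ends : ∀ e ∈ G.edgeSet, ∃ x y, G.IsLink e x y ∧ arc e 0 = vert x ∧ arc e 1 = vert y
  arc_injOn : ∀ e ∈ G.edgeSet, Set.InjOn (arc e) (Set.Ioo 0 1)
  arc_ne_vert : ∀ e ∈ G.edgeSet, ∀ t ∈ Set.Ioo (0 : unitInterval) 1, ∀ x ∈ G.vertexSet,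
    arc e t ≠ vert x
  arc_disjoint : ∀ e ∈ G.edgeSet, ∀ f ∈ G.edgeSet, e ≠ f →
    ∀ s ∈ Set.Ioo (0 : unitInterval) 1, ∀ t ∈ Set.Ioo (0 : unitInterval) 1, arc e s ≠ arc f t

/-- The image of an embedded graph. -/
def SpaceEmbedding.image {G : Graph α β} {X : Type*} [TopologicalSpace X]
    (φ : G.SpaceEmbedding X) : Set X :=
  φ.vert '' G.vertexSet ∪ ⋃ e ∈ G.edgeSet, Set.range (φ.arc e)

/-- A face: a connected component of the complement of the image. -/
def SpaceEmbedding.IsFace {G : Graph α β} {X : Type*} [TopologicalSpace X]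
    (φ : G.SpaceEmbedding X) (U : Set X) : Prop :=
  ∃ p ∈ φ.imageᶜ, U = connectedComponentIn φ.imageᶜ p

/-- Some face of the embedding is bounded by a cycle of length `n`. -/
def SpaceEmbedding.HasFacialCycle {G : Graph α β} {X : Type*} [TopologicalSpace X]
    (φ : G.SpaceEmbedding X) (n : ℕ) : Prop :=
  ∃ (U : Set X) (v : ZMod n → α) (e : ZMod n → β), φ.IsFace U ∧ G.IsCycleOn n v e ∧
    frontier U = ⋃ i, Set.range (φ.arc (e i))

/-- A graph is toroidal if it embeds into the torus `(ℝ / ℤ)²`. -/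
def IsToroidal (G : Graph α β) : Prop :=
  Nonempty (G.SpaceEmbedding (UnitAddTorus (Fin 2)))

/-- The three ways of attaching an edge to `G`. The vertices `u`, `v` are new.
* `lollipop`: subdivide the edge `e = xy` by `u`, add the vertex `v`, an edge `uv` and a loop `vv`;
* `parallel`: subdivide the edge `e = xy` twice, to `x u v y`, and add a second edge `uv`;
* `join`: subdivide distinct edges `e₁ = x₁y₁` by `u` and `e₂ = x₂y₂` by `v`, add an edge `uv`. -/
inductive EdgeAddition (G : Graph α β) where
  | lollipop (e : β) (x y : α) (h : G.IsLink e x y)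
  | parallel (e : β) (x y : α) (h : G.IsLink e x y)
  | join (e₁ : β) (x₁ y₁ : α) (h₁ : G.IsLink e₁ x₁ y₁)
      (e₂ : β) (x₂ y₂ : α) (h₂ : G.IsLink e₂ x₂ y₂) (hne : e₁ ≠ e₂)

namespace EdgeAddition

variable {G : Graph α β}

/-- The edges of `G` that are subdivided. -/
def subdivided : G.EdgeAddition → Set β
  | lollipop e _ _ _ => {e}
  | parallel e _ _ _ => {e}
  | join e₁ _ _ _ e₂ _ _ _ _ => {e₁, e₂}

/-- The ends of the edges that are not edges of `G`; `u` is `Sum.inr 0` and `v` is `Sum.inr 1`. -/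
def newEnds : G.EdgeAddition → List (Sym2 (α ⊕ Fin 2))
  | lollipop _ x y _ =>
      [s(.inl x, .inr 0), s(.inr 0, .inl y), s(.inr 0, .inr 1), s(.inr 1, .inr 1)]
  | parallel _ x y _ =>
      [s(.inl x, .inr 0), s(.inr 0, .inr 1), s(.inr 1, .inl y), s(.inr 0, .inr 1)]
  | join _ x₁ y₁ _ _ x₂ y₂ _ _ =>
      [s(.inl x₁, .inr 0), s(.inr 0, .inl y₁), s(.inl x₂, .inr 1), s(.inr 1, .inl y₂),
        s(.inr 0, .inr 1)]

/-- The incidence relation of `G ∪ e`: the edges of `G` that are not subdivided, and one edge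
`Sum.inr i` for each entry of `newEnds`, in position `i`. -/
def Link (c : G.EdgeAddition) : β ⊕ ℕ → α ⊕ Fin 2 → α ⊕ Fin 2 → Prop
  | .inl f, a, b => f ∉ c.subdivided ∧ ∃ x y, G.IsLink f x y ∧ a = .inl x ∧ b = .inl y
  | .inr i, a, b => c.newEnds[i]? = some s(a, b)

theorem mem_of_newEnds (c : G.EdgeAddition) {i : ℕ} {a b : α ⊕ Fin 2}
    (h : c.newEnds[i]? = some s(a, b)) : Sum.elim (· ∈ G.vertexSet) (fun _ => True) a := by
  have h' : s(a, b) ∈ c.newEnds := List.mem_of_getElem? h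
  cases c with
  | lollipop e x y hl =>
    have := hl.left_mem
    have := hl.right_mem
    simp only [newEnds, List.mem_cons, List.not_mem_nil, Sym2.eq_iff] at h'
    rcases a with a | a <;> simp_all
    aesop
  | parallel e x y hl =>
    have := hl.left_mem
    have := hl.right_mem
    simp only [newEnds, List.mem_cons, List.not_mem_nil, Sym2.eq_iff] at h'
    rcases a with a | a <;> simp_all
    aesop
  | join e₁ x₁ y₁ hl e₂ x₂ y₂ hl' hne =>
    have := hl.left_mem
    have := hl.right_mem
    have := hl'.left_mem
    have := hl'.right_mem
    simp only [newEnds, List.mem_cons, List.not_mem_nil, Sym2.eq_iff] at h'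
    rcases a with a | a <;> simp_all
    aesop

/-- `f` is one of the edges of `G ∪ e` into which the edge `g` of `G` is cut. -/
def IsPiece : G.EdgeAddition → β ⊕ ℕ → β → Prop
  | _, .inl f, g => f = g
  | lollipop e _ _ _, .inr i, g => g = e ∧ (i = 0 ∨ i = 1)
  | parallel e _ _ _, .inr i, g => g = e ∧ (i = 0 ∨ i = 1 ∨ i = 2)
  | join e₁ _ _ _ e₂ _ _ _ _, .inr i, g =>
      (g = e₁ ∧ (i = 0 ∨ i = 1)) ∨ (g = e₂ ∧ (i = 2 ∨ i = 3))

/-- The new edge joins subdivision points of the two distinct edges `f` and `g` of `G`. -/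
def Joins : G.EdgeAddition → β → β → Prop
  | join e₁ _ _ _ e₂ _ _ _ _, f, g => (e₁ = f ∧ e₂ = g) ∨ (e₁ = g ∧ e₂ = f)
  | _, _, _ => False

end EdgeAddition

/-- The multigraph `G ∪ e` for a choice of `e`. -/
def addEdge (G : Graph α β) (c : G.EdgeAddition) : Graph (α ⊕ Fin 2) (β ⊕ ℕ) where
  vertexSet := Sum.inl '' G.vertexSet ∪ Set.range Sum.inr
  IsLink := c.Link
  isLink_symm := by
    rintro (f | i) - <;> refine ⟨fun a b h => ?_⟩
    · obtain ⟨hf, x, y, h, rfl, rfl⟩ := h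
      exact ⟨hf, y, x, h.symm, rfl, rfl⟩
    · simpa only [EdgeAddition.Link, Sym2.eq_swap] using h
  eq_or_eq_of_isLink_of_isLink := by
    rintro (f | i) a b a' b' h h'
    · obtain ⟨-, x, y, h, rfl, rfl⟩ := h
      obtain ⟨-, x', y', h', rfl, rfl⟩ := h'
      simpa using h.left_eq_or_eq h'
    · have := h.symm.trans h'
      simp only [Option.some.injEq, Sym2.eq_iff] at this
      tauto
  left_mem_of_isLink := by
    rintro (f | i) a b h
    · obtain ⟨-, x, y, h, rfl, rfl⟩ := h
      exact .inl ⟨x, h.left_mem, rfl⟩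
    · have := c.mem_of_newEnds h
      rcases a with a | a
      · exact .inl ⟨a, this, rfl⟩
      · exact .inr ⟨a, rfl⟩

/-- The embedding `ψ` of `G ∪ e` extends the embedding `φ` of `G`: the vertices of `G` keep their
place, and each edge of `G` is the union of the pieces into which it is cut. -/
def SpaceEmbedding.Extends {G : Graph α β} {X : Type*} [TopologicalSpace X] {c : G.EdgeAddition}
    (ψ : (G.addEdge c).SpaceEmbedding X) (φ : G.SpaceEmbedding X) : Prop :=
  (∀ x ∈ G.vertexSet, ψ.vert (.inl x) = φ.vert x) ∧
  ∀ g ∈ G.edgeSet, Set.range (φ.arc g) =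
    ⋃ f ∈ {f | f ∈ (G.addEdge c).edgeSet ∧ c.IsPiece f g}, Set.range (ψ.arc f)

end Graph

/-- The vertices `A, A', B, B', 1, …, 8` of `F₁₄` (`Ap`, `Bp` are the primed ones). -/
inductive F14Vertex
  | A | Ap | B | Bp | n1 | n2 | n3 | n4 | n5 | n6 | n7 | n8
  deriving DecidableEq

open F14Vertex in
/-- The cubic graph `F₁₄`: the 8-cycle `1 2 … 8` together with two trees, one with edges
`AA', A1, A5, A'3, A'7`, the other with edges `BB', B2, B6, B'4, B'8`. -/
def F14 : SimpleGraph F14Vertex :=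
  SimpleGraph.fromEdgeSet
    {s(A, Ap), s(B, Bp),
      s(A, n1), s(A, n5), s(Ap, n3), s(Ap, n7), s(B, n2), s(B, n6), s(Bp, n4), s(Bp, n8),
      s(n1, n2), s(n2, n3), s(n3, n4), s(n4, n5), s(n5, n6), s(n6, n7), s(n7, n8), s(n8, n1)}

/-- `F₁₄` as a multigraph. -/
def F14Graph : Graph F14Vertex (Sym2 F14Vertex) := Graph.ofSimpleGraph F14

open F14Vertex in
/-- Twelve pairs of edges of `F₁₄`. -/
def F14Cases : List (Sym2 F14Vertex × Sym2 F14Vertex) :=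
  [(s(A, Ap), s(B, Bp)), (s(A, Ap), s(B, n2)), (s(A, Ap), s(n1, n2)),
    (s(A, n1), s(Ap, n3)), (s(A, n1), s(B, n2)), (s(A, n1), s(B, n6)),
    (s(A, n1), s(n2, n3)), (s(A, n1), s(n3, n4)), (s(A, n1), s(n4, n5)),
    (s(n1, n2), s(n3, n4)), (s(n1, n2), s(n4, n5)), (s(n1, n2), s(n5, n6))]

/-! Draw `F₁₄` with straight edges on the torus `ℝ² / ℤ²`. Three of the faces, an octagon and two
hexagons, lift to convex polygons of the plane. Any two points on the boundary of a convex polygon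
are joined by a curve through its interior, and at any such point a lollipop can be hung into the
interior. So `F₁₄ ∪ e` embeds, extending the drawing, whenever the edges subdivided by `e` are
sides of one of the three faces. Automorphisms of `F₁₄` reduce every `e` to this case: a rotation
of the cycle `1 2 … 8` by one step and a reflection of it extend to `F₁₄`, and already under the
group they generate any two edges can be moved to sides of a common face.

If `F₁₄ ∪ e` has girth at least four, then `e` joins two edges without a common end, since any
other choice creates a cycle of length at most three. These pairs form the twelve orbits.
-/

open Set
open scoped Pointwise

/-- The interior of a curve: the points strictly between its ends. -/
def openArc {X : Type*} (a : unitInterval → X) : Set X := a '' Ioo 0 1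

/-- The curve `a` is simple and runs through `S`, except possibly at its ends, which may also
coincide. -/
structure IsArcThrough {X : Type*} (S : Set X) (a : unitInterval → X) : Prop where
  injOn : InjOn a (Ioo 0 1)
  openArc_subset : openArc a ⊆ S

namespace IsArcThrough

variable {X Y : Type*} {S T : Set X} {a : unitInterval → X}

theorem mono (h : IsArcThrough S a) (hST : S ⊆ T) : IsArcThrough T a :=
  ⟨h.injOn, h.openArc_subset.trans hST⟩

theorem comp (h : IsArcThrough S a) {f : X → Y} (hf : InjOn f S) :
    IsArcThrough (f '' S) (f ∘ a) :=
  ⟨hf.comp h.injOn (mapsTo_iff_image_subset.2 h.openArc_subset),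
    (image_comp f a _).trans_subset (image_mono h.openArc_subset)⟩

end IsArcThrough

theorem mul_one_sub_mem_Ioo {t : ℝ} (ht : t ∈ Ioo 0 1) : t * (1 - t) ∈ Ioo 0 1 := by
  obtain ⟨h0, h1⟩ := ht
  constructor <;> nlinarith

theorem openSegment_subset_range_lineMap_midpoint {E : Type*} [AddCommGroup E] [Module ℝ E]
    (P q : E) :
    openSegment ℝ P q ⊆ range (AffineMap.lineMap q (midpoint ℝ P q) : ℝ → E) := by
  rw [openSegment_symm, openSegment_eq_image_lineMap]
  rintro _ ⟨t, -, rfl⟩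
  refine ⟨2 * t, ?_⟩
  simp only [midpoint_eq_smul_add, invOf_eq_inv, AffineMap.lineMap_apply_module]
  module

section ConvexOpenSets

variable {E : Type*} [AddCommGroup E] [Module ℝ E] [TopologicalSpace E] [IsTopologicalAddGroup E]
  [ContinuousSMul ℝ E] {U : Set E} {P Q q : E}

theorem exists_mem_linearIndependent_sub (hE : 1 < Module.rank ℝ E) (hU : IsOpen U)
    (hne : U.Nonempty) {u : E} (hu : u ≠ 0) (P : E) :
    ∃ c ∈ U, LinearIndependent ℝ ![u, c - P] := by
  by_contra! h
  have hsub : (fun c => c + P) ⁻¹' U ⊆ (ℝ ∙ u : Submodule ℝ E) := fun c hc => by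
    simpa [LinearIndependent.pair_iff' hu, Submodule.mem_span_singleton] using h _ hc
  have htop : (ℝ ∙ u : Submodule ℝ E) = ⊤ := by
    refine Submodule.eq_top_of_nonempty_interior' _ (Nonempty.mono
      (interior_maximal hsub (hU.preimage (continuous_add_const P))) ?_)
    obtain ⟨c, hc⟩ := hne
    exact ⟨c - P, by simpa using hc⟩
  have hrank := rank_span_le (R := ℝ) {u}
  rw [htop, rank_top, Cardinal.mk_singleton] at hrank
  exact hrank.not_gt hE

theorem openArc_segment (P Q : E) : openArc (Path.segment P Q) = openSegment ℝ P Q := by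
  have : Ioo (0 : ℝ) 1 = Subtype.val '' Ioo (0 : unitInterval) 1 :=
    (image_subtype_val_Ioo (s := Icc (0 : ℝ) 1) 0 1).symm
  rw [openSegment_eq_image_lineMap, this, image_image]
  rfl

/-- The curve from `P` to `Q` that deviates from the segment towards `c`. -/
def bentPath (P Q c : E) : Path P Q where
  toFun t := AffineMap.lineMap (AffineMap.lineMap P Q (t : ℝ)) c ((t : ℝ) * (1 - t))
  continuous_toFun := by
    simp only [AffineMap.lineMap_apply_module]
    fun_prop
  source' := by simp
  target' := by simp

theorem isArcThrough_bentPath (hU : IsOpen U) (hc : Convex ℝ U) (hP : P ∈ closure U)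
    (hQ : Q ∈ closure U) {c : E} (hcU : c ∈ U) (hli : LinearIndependent ℝ ![Q - P, c - P]) :
    IsArcThrough U (bentPath P Q c) where
  injOn := by
    have coord (t : unitInterval) : bentPath P Q c t =
        ((1 - (t : ℝ) * (1 - t)) * t) • (Q - P) + ((t : ℝ) * (1 - t)) • (c - P) + P := by
      change AffineMap.lineMap (AffineMap.lineMap P Q (t : ℝ)) c ((t : ℝ) * (1 - t)) = _
      simp only [AffineMap.lineMap_apply_module]
      module
    intro t ht t' _ h
    rw [coord, coord, add_left_inj] at h
    obtain ⟨hQ, hc⟩ := hli.eq_of_pair h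
    rw [hc] at hQ
    have := mul_one_sub_mem_Ioo (t := t) ht
    exact Subtype.ext (mul_left_cancel₀ (sub_pos.2 (hc ▸ this.2)).ne' hQ)
  openArc_subset := by
    rintro _ ⟨t, ht, rfl⟩
    have hmem : AffineMap.lineMap P Q (t : ℝ) ∈ closure U :=
      hc.closure.lineMap_mem hP hQ ⟨t.2.1, t.2.2⟩
    have := hc.openSegment_closure_interior_subset_interior hmem (hU.interior_eq.symm ▸ hcU)
    rw [openSegment_eq_image_lineMap, hU.interior_eq] at this
    exact this ⟨_, mul_one_sub_mem_Ioo ht, rfl⟩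

theorem exists_path_isArcThrough (hE : 1 < Module.rank ℝ E) (hU : IsOpen U)
    (hne : U.Nonempty) (hc : Convex ℝ U) (hP : P ∈ closure U) (hQ : Q ∈ closure U) (hPQ : P ≠ Q) :
    ∃ γ : Path P Q, IsArcThrough U γ := by
  obtain ⟨c, hcU, hli⟩ := exists_mem_linearIndependent_sub hE hU hne (sub_ne_zero.2 hPQ.symm) P
  exact ⟨_, isArcThrough_bentPath hU hc hP hQ hcU hli⟩

/-- The loop at `q` that runs inside the triangle `q c w`, leaving `q` towards `c` and returning
from `w`. -/
def triangleLoop (q c w : E) : Path q q where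
  toFun t := AffineMap.lineMap q (AffineMap.lineMap c w (t : ℝ)) ((t : ℝ) * (1 - t))
  continuous_toFun := by
    simp only [AffineMap.lineMap_apply_module]
    fun_prop
  source' := by simp
  target' := by simp

theorem triangleLoop_apply (q c w : E) (t : unitInterval) :
    triangleLoop q c w t = ((t : ℝ) * (1 - t) * (1 - t)) • (c - q) +
      ((t : ℝ) * (1 - t) * t) • (w - q) + q := by
  change AffineMap.lineMap q (AffineMap.lineMap c w (t : ℝ)) ((t : ℝ) * (1 - t)) = _
  simp only [AffineMap.lineMap_apply_module]
  module

theorem isArcThrough_triangleLoop (hc : Convex ℝ U) {c w : E} (hq : q ∈ U) (hcU : c ∈ U)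
    (hwU : w ∈ U) (hli : LinearIndependent ℝ ![c - q, w - q]) :
    IsArcThrough U (triangleLoop q c w) where
  injOn := by
    intro t ht t' _ h
    rw [triangleLoop_apply, triangleLoop_apply, add_left_inj] at h
    obtain ⟨hc, hw⟩ := hli.eq_of_pair h
    have hs : (t : ℝ) * (1 - t) = t' * (1 - t') := by linear_combination hc + hw
    rw [hs] at hw
    exact Subtype.ext (mul_left_cancel₀ (hs ▸ (mul_one_sub_mem_Ioo ht).1).ne' hw)
  openArc_subset := by
    rintro _ ⟨t, ht, rfl⟩
    have hs := mul_one_sub_mem_Ioo ht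
    exact hc.lineMap_mem hq (hc.lineMap_mem hcU hwU ⟨t.2.1, t.2.2⟩) ⟨hs.1.le, hs.2.le⟩

theorem disjoint_openArc_triangleLoop {c w : E} (hli : LinearIndependent ℝ ![c - q, w - q]) :
    Disjoint (range (AffineMap.lineMap q c : ℝ → E)) (openArc (triangleLoop q c w)) := by
  rw [disjoint_left]
  rintro _ ⟨r, rfl⟩ ⟨t, ht, h⟩
  have hr : AffineMap.lineMap q c r = r • (c - q) + (0 : ℝ) • (w - q) + q := by
    rw [AffineMap.lineMap_apply_module]
    module
  rw [triangleLoop_apply, hr, add_left_inj] at h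
  exact (mul_pos (mul_one_sub_mem_Ioo ht).1 ht.1).ne' (hli.eq_of_pair h).2

theorem exists_path_loop_isArcThrough (hE : 1 < Module.rank ℝ E) (hU : IsOpen U)
    (hc : Convex ℝ U) (hP : P ∈ closure U) (hq : q ∈ U) (hPq : P ≠ q) :
    ∃ (γ : Path P q) (l : Path q q), IsArcThrough (U \ {q}) γ ∧ IsArcThrough (U \ {q}) l ∧
      Disjoint (openArc γ) (openArc l) := by
  have hseg : openSegment ℝ P q ⊆ U := by
    simpa only [hU.interior_eq] using
      hc.openSegment_closure_interior_subset_interior hP (hU.interior_eq.symm ▸ hq)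
  set c : E := midpoint ℝ P q
  have hcU : c ∈ U := hseg (midpoint_mem_openSegment P q)
  obtain ⟨w, hwU, hli⟩ := exists_mem_linearIndependent_sub hE hU ⟨q, hq⟩
    (u := c - q) (sub_ne_zero.2 fun h => hPq ((midpoint_eq_right_iff ℝ).1 h)) q
  have hdisj := disjoint_openArc_triangleLoop hli
  refine ⟨.segment P q, triangleLoop q c w,
    ⟨(Path.segment_injective_of_ne hPq).injOn, ?_⟩,
    ⟨(isArcThrough_triangleLoop hc hq hcU hwU hli).injOn, subset_sdiff_singleton
      (isArcThrough_triangleLoop hc hq hcU hwU hli).openArc_subset ?_⟩, ?_⟩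
  · rw [openArc_segment]
    exact subset_sdiff_singleton hseg fun h => hPq (right_mem_openSegment_iff.1 h)
  · exact disjoint_left.1 hdisj ⟨0, by simp⟩
  · rw [openArc_segment]
    exact hdisj.mono_left (openSegment_subset_range_lineMap_midpoint P q)

end ConvexOpenSets

section Cut

variable {X : Type*} [TopologicalSpace X] {a b p q : X} {S : Set X}

theorem image_symm_Ioo_zero_one : unitInterval.symm '' Ioo 0 1 = Ioo 0 1 := by
  simpa using unitInterval.continuous_symm.continuousOn.image_Ioo_of_strictAntiOn
    (zero_le_one (α := unitInterval)) (unitInterval.strictAnti_symm.strictAntiOn _)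

theorem openArc_symm (γ : Path a b) : openArc γ.symm = openArc γ := by
  change (γ ∘ unitInterval.symm) '' Ioo 0 1 = _
  rw [image_comp, image_symm_Ioo_zero_one, openArc]

theorem IsArcThrough.symm {γ : Path a b} (h : IsArcThrough S γ) : IsArcThrough S γ.symm where
  injOn := h.injOn.comp unitInterval.symm_bijective.injective.injOn
    (mapsTo_iff_image_subset.2 image_symm_Ioo_zero_one.subset)
  openArc_subset := (openArc_symm γ).trans_subset h.openArc_subset

theorem strictMono_convexComb {s t : unitInterval} (h : s < t) :
    StrictMono (Icc.convexComb s t) := by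
  intro r r' hr
  have h' : (s : ℝ) < t := h
  have hr' : (r : ℝ) < r' := hr
  change (Icc.convexComb s t r : ℝ) < Icc.convexComb s t r'
  simp only [Icc.coe_convexComb]
  nlinarith

theorem image_convexComb_Ioo {s t : unitInterval} (h : s < t) :
    Icc.convexComb s t '' Ioo 0 1 = Ioo s t := by
  have hcont : Continuous (Icc.convexComb s t) := by unfold Icc.convexComb; fun_prop
  simpa using hcont.continuousOn.image_Ioo_of_strictMonoOn (zero_le_one (α := unitInterval))
    ((strictMono_convexComb h).strictMonoOn _)

theorem openArc_subpath (γ : Path a b) {s t : unitInterval} (h : s < t) :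
    openArc (γ.subpath s t) = γ '' Ioo s t := by
  change (γ ∘ Icc.convexComb s t) '' Ioo 0 1 = _
  rw [image_comp, image_convexComb_Ioo h]

theorem isArcThrough_subpath {γ : Path a b} (hγ : InjOn γ (Ioo 0 1)) {s t : unitInterval}
    (h : s < t) : IsArcThrough (γ '' Ioo s t) (γ.subpath s t) where
  injOn := (hγ.mono (Ioo_subset_Ioo (α := unitInterval) s.2.1 t.2.2)).comp
    (strictMono_convexComb h).injective.injOn
    (mapsTo_iff_image_subset.2 (image_convexComb_Ioo h).subset)
  openArc_subset := (openArc_subpath γ h).subset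

/-- The curves `γ₁` and `γ₂` are the two parts into which the inner point `p` cuts the simple
curve `γ`. -/
structure IsCutAt (γ : Path a b) (p : X) (γ₁ : Path a p) (γ₂ : Path p b) : Prop where
  mem : p ∈ openArc γ
  left : IsArcThrough (openArc γ \ {p}) γ₁
  right : IsArcThrough (openArc γ \ {p}) γ₂
  disjoint : Disjoint (openArc γ₁) (openArc γ₂)
  range_union : range γ₁ ∪ range γ₂ = range γ

theorem IsCutAt.openArc_left_subset {γ : Path a b} {γ₁ : Path a p} {γ₂ : Path p b}
    (h : IsCutAt γ p γ₁ γ₂) (hq : q ∈ openArc γ₂) : openArc γ₁ ⊆ openArc γ \ {p, q} :=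
  subset_sdiff.2 ⟨h.left.openArc_subset.trans sdiff_subset, disjoint_insert_right.2
    ⟨fun hp => (h.left.openArc_subset hp).2 rfl,
      disjoint_singleton_right.2 (disjoint_right.1 h.disjoint hq)⟩⟩

theorem exists_isCutAt_apply {γ : Path a b} (hγ : InjOn γ (Ioo 0 1)) {t : unitInterval}
    (ht : t ∈ Ioo 0 1) : ∃ γ₁ γ₂, IsCutAt γ (γ t) γ₁ γ₂ ∧ openArc γ₂ = γ '' Ioo t 1 := by
  have sub₁ : Ioo 0 t ⊆ Ioo 0 1 \ {t} := fun r hr => ⟨⟨hr.1, hr.2.trans ht.2⟩, hr.2.ne⟩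
  have sub₂ : Ioo t 1 ⊆ Ioo 0 1 \ {t} := fun r hr => ⟨⟨ht.1.trans hr.1, hr.2⟩, hr.1.ne'⟩
  have image_sdiff : γ '' (Ioo 0 1 \ {t}) = openArc γ \ {γ t} := by
    rw [hγ.image_sdiff_subset (singleton_subset_iff.2 ht), image_singleton, openArc]
  refine ⟨(γ.subpath 0 t).cast γ.source.symm rfl, (γ.subpath t 1).cast rfl γ.target.symm,
    ⟨mem_image_of_mem γ ht, ?_, ?_, ?_, ?_⟩, openArc_subpath γ ht.2⟩
  · exact image_sdiff ▸ (isArcThrough_subpath hγ ht.1).mono (image_mono sub₁)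
  · exact image_sdiff ▸ (isArcThrough_subpath hγ ht.2).mono (image_mono sub₂)
  · rw [Path.cast_coe, Path.cast_coe, openArc_subpath γ ht.1, openArc_subpath γ ht.2,
      disjoint_iff_inter_eq_empty, ← hγ.image_inter (sub₁.trans sdiff_subset)
      (sub₂.trans sdiff_subset), (Ioo_disjoint_Ioo.2 (by simp)).inter_eq, image_empty]
  · rw [Path.cast_coe, Path.cast_coe, Path.range_subpath_of_le _ _ _ ht.1.le,
      Path.range_subpath_of_le _ _ _ ht.2.le, ← image_union,
      Icc_union_Icc_eq_Icc ht.1.le ht.2.le, ← unitInterval.univ_eq_Icc, image_univ]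

theorem exists_isCutAt {γ : Path a b} (hγ : InjOn γ (Ioo 0 1)) (hp : p ∈ openArc γ) :
    ∃ γ₁ γ₂, IsCutAt γ p γ₁ γ₂ := by
  obtain ⟨t, ht, rfl⟩ := hp
  obtain ⟨γ₁, γ₂, h, -⟩ := exists_isCutAt_apply hγ ht
  exact ⟨γ₁, γ₂, h⟩

theorem exists_isCutAt_isCutAt {γ : Path a b} (hγ : InjOn γ (Ioo 0 1)) (hp : p ∈ openArc γ)
    (hq : q ∈ openArc γ) (hpq : p ≠ q) :
    (∃ γ₁ γ₂ γ₂₁ γ₂₂, IsCutAt γ p γ₁ γ₂ ∧ IsCutAt γ₂ q γ₂₁ γ₂₂) ∨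
      ∃ γ₁ γ₂ γ₂₁ γ₂₂, IsCutAt γ q γ₁ γ₂ ∧ IsCutAt γ₂ p γ₂₁ γ₂₂ := by
  obtain ⟨s, hs, rfl⟩ := hp
  obtain ⟨t, ht, rfl⟩ := hq
  wlog hst : s < t generalizing s t
  · exact (this t ht s hs hpq.symm
      ((lt_or_gt_of_ne fun h => hpq (congrArg γ h)).resolve_left hst)).symm
  obtain ⟨γ₁, γ₂, hcut, hγ₂⟩ := exists_isCutAt_apply hγ hs
  have hmem : γ t ∈ openArc γ₂ := hγ₂.symm ▸ mem_image_of_mem γ ⟨hst, ht.2⟩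
  obtain ⟨γ₂₁, γ₂₂, hcut'⟩ := exists_isCutAt hcut.right.injOn hmem
  exact .inl ⟨γ₁, γ₂, γ₂₁, γ₂₂, hcut, hcut'⟩

end Cut

namespace Graph.SpaceEmbedding

variable {α β X : Type*} [TopologicalSpace X] {G : Graph α β} (φ : G.SpaceEmbedding X) {e f : β}

theorem exists_path {x y : α} (h : G.IsLink e x y) :
    ∃ γ : Path (φ.vert x) (φ.vert y), InjOn γ (Ioo 0 1) ∧ openArc γ = openArc (φ.arc e) ∧
      range γ = range (φ.arc e) := by
  obtain ⟨x', y', h', h0, h1⟩ := φ.arc_ends e h.edge_mem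
  let γ : Path (φ.vert x') (φ.vert y') := ⟨φ.arc e, h0, h1⟩
  have hγ : InjOn γ (Ioo 0 1) := φ.arc_injOn e h.edge_mem
  obtain ⟨rfl, rfl⟩ | ⟨rfl, rfl⟩ := h.eq_and_eq_or_eq_and_eq h'
  · exact ⟨γ, hγ, rfl, rfl⟩
  · exact ⟨γ.symm, (IsArcThrough.symm ⟨hγ, subset_univ _⟩).injOn, openArc_symm γ, γ.symm_range⟩

theorem disjoint_openArc (he : e ∈ G.edgeSet) (hf : f ∈ G.edgeSet) (hef : e ≠ f) :
    Disjoint (openArc (φ.arc e)) (openArc (φ.arc f)) := by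
  rw [disjoint_left]
  rintro _ ⟨s, hs, rfl⟩ ⟨t, ht, h⟩
  exact φ.arc_disjoint e he f hf hef s hs t ht h.symm

theorem openArc_subset_image (he : e ∈ G.edgeSet) : openArc (φ.arc e) ⊆ φ.image :=
  fun _ hz => .inr (mem_biUnion he (image_subset_range _ _ hz))

/-- The part of the surface that is free for drawing once the edges that `c` subdivides are
erased. -/
def vacated (c : G.EdgeAddition) : Set X :=
  (φ.vert '' G.vertexSet ∪ ⋃ f ∈ G.edgeSet \ c.subdivided, openArc (φ.arc f))ᶜ

variable {φ} {c : G.EdgeAddition}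

theorem compl_image_subset_vacated : φ.imageᶜ ⊆ φ.vacated c :=
  compl_subset_compl.2 <| union_subset_union_right _ <| iUnion₂_subset fun _ hf _ hz =>
    mem_biUnion hf.1 (image_subset_range _ _ hz)

theorem openArc_subset_vacated (he : e ∈ G.edgeSet) (hc : e ∈ c.subdivided) :
    openArc (φ.arc e) ⊆ φ.vacated c := by
  refine subset_compl_iff_disjoint_right.2 (disjoint_union_right.2 ⟨?_, ?_⟩)
  · rw [disjoint_left]
    rintro _ ⟨t, ht, rfl⟩ ⟨x, hx, h⟩
    exact φ.arc_ne_vert e he t ht x hx h.symm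
  · exact disjoint_iUnion₂_right.2 fun f hf =>
      φ.disjoint_openArc he hf.1 fun h => hf.2 (h ▸ hc)

theorem ne_vert_of_mem_vacated {z : X} (hz : z ∈ φ.vacated c) {x : α} (hx : x ∈ G.vertexSet) :
    z ≠ φ.vert x :=
  fun h => hz (.inl ⟨x, hx, h.symm⟩)

theorem disjoint_openArc_vacated (he : e ∈ G.edgeSet) (hc : e ∉ c.subdivided) :
    Disjoint (openArc (φ.arc e)) (φ.vacated c) :=
  disjoint_compl_right_iff_subset.2 fun _ hz => .inr (mem_biUnion ⟨he, hc⟩ hz)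

/-- The images of the two new vertices and, in the order of `c.newEnds`, of the new edges of
`G ∪ e`, drawn in the space that `c` vacates. -/
structure AddedArcs (φ : G.SpaceEmbedding X) (c : G.EdgeAddition) where
  point : Fin 2 → X
  arcs : List C(unitInterval, X)
  point_injective : Function.Injective point
  point_mem : ∀ i, point i ∈ φ.vacated c
  arc_ends : List.Forall₂ (fun (s : Sym2 (α ⊕ Fin 2)) (a : C(unitInterval, X)) => ∃ x y,
    s = s(x, y) ∧ a 0 = Sum.elim φ.vert point x ∧ a 1 = Sum.elim φ.vert point y) c.newEnds arcs
  isArcThrough : ∀ a ∈ arcs, IsArcThrough (φ.vacated c \ range point) a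
  arcs_disjoint : arcs.Pairwise fun a b : C(unitInterval, X) => Disjoint (openArc a) (openArc b)

end Graph.SpaceEmbedding

namespace Graph.EdgeAddition

variable {α β : Type*} {G : Graph α β} {c : G.EdgeAddition}

theorem inl_mem_edgeSet_addEdge {f : β} :
    .inl f ∈ (G.addEdge c).edgeSet ↔ f ∈ G.edgeSet \ c.subdivided := by
  rw [Graph.edge_mem_iff_exists_isLink, mem_sdiff, Graph.edge_mem_iff_exists_isLink]
  constructor
  · rintro ⟨_, _, hf, x, y, h, -, -⟩
    exact ⟨⟨x, y, h⟩, hf⟩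
  · rintro ⟨⟨x, y, h⟩, hf⟩
    exact ⟨_, _, hf, x, y, h, rfl, rfl⟩

theorem inr_mem_edgeSet_addEdge {i : ℕ} :
    .inr i ∈ (G.addEdge c).edgeSet ↔ i < c.newEnds.length := by
  rw [Graph.edge_mem_iff_exists_isLink]
  constructor
  · rintro ⟨a, b, h⟩
    exact (List.getElem?_eq_some_iff.1 h).1
  · intro h
    obtain ⟨⟨a, b⟩, hab⟩ := Quot.exists_rep c.newEnds[i]
    exact ⟨a, b, List.getElem?_eq_some_iff.2 ⟨h, hab.symm⟩⟩

theorem inl_mem_vertexSet_addEdge {x : α} :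
    .inl x ∈ (G.addEdge c).vertexSet ↔ x ∈ G.vertexSet := by
  simp [Graph.addEdge]

end Graph.EdgeAddition

namespace Graph.SpaceEmbedding.AddedArcs
open EdgeAddition

variable {α β X : Type*} [TopologicalSpace X] {G : Graph α β} {φ : G.SpaceEmbedding X}
  {c : G.EdgeAddition} (D : φ.AddedArcs c) {i j : ℕ}

/-- The `i`-th new arc; the value for `i ≥ D.arcs.length` is irrelevant. -/
def arc (i : ℕ) : C(unitInterval, X) :=
  D.arcs.getD i (.const _ (D.point 0))

theorem length_arcs : D.arcs.length = c.newEnds.length := D.arc_ends.length_eq.symm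

theorem arc_mem (hi : i < c.newEnds.length) : D.arc i ∈ D.arcs := by
  rw [arc, List.getD_eq_getElem _ _ (D.length_arcs.symm ▸ hi)]
  exact List.getElem_mem _

theorem exists_isLink (hi : i < c.newEnds.length) : ∃ x y, (G.addEdge c).IsLink (.inr i) x y ∧
    D.arc i 0 = Sum.elim φ.vert D.point x ∧ D.arc i 1 = Sum.elim φ.vert D.point y := by
  have hi' : i < D.arcs.length := D.length_arcs.symm ▸ hi
  obtain ⟨x, y, h, h0, h1⟩ := D.arc_ends.get hi hi'
  rw [arc, List.getD_eq_getElem _ _ hi']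
  exact ⟨x, y, List.getElem?_eq_some_iff.2 ⟨hi, h⟩, h0, h1⟩

theorem disjoint_openArc_arc (hi : i < c.newEnds.length) (hj : j < c.newEnds.length)
    (hij : i ≠ j) : Disjoint (openArc (D.arc i)) (openArc (D.arc j)) := by
  wlog h : i < j generalizing i j
  · exact (this hj hi hij.symm (hij.lt_or_gt.resolve_left h)).symm
  rw [arc, arc, List.getD_eq_getElem _ _ (D.length_arcs.symm ▸ hi),
    List.getD_eq_getElem _ _ (D.length_arcs.symm ▸ hj)]
  exact List.pairwise_iff_getElem.1 D.arcs_disjoint _ _ _ _ h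

theorem disjoint_openArc_inl (hi : i < c.newEnds.length) {f : β}
    (hf : f ∈ G.edgeSet \ c.subdivided) :
    Disjoint (openArc (φ.arc f)) (openArc (D.arc i)) :=
  (disjoint_openArc_vacated hf.1 hf.2).mono_right
    ((D.isArcThrough _ (D.arc_mem hi)).openArc_subset.trans sdiff_subset)

/-- The embedding of `G ∪ e` that draws the new arcs and keeps the edges that are not
subdivided. -/
def toSpaceEmbedding : (G.addEdge c).SpaceEmbedding X where
  vert := Sum.elim φ.vert D.point
  arc := Sum.elim φ.arc D.arc
  vert_injOn := by
    rintro (x | i) hx (y | j) hy h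
    · exact congrArg _ (φ.vert_injOn (inl_mem_vertexSet_addEdge.1 hx)
        (inl_mem_vertexSet_addEdge.1 hy) h)
    · exact (ne_vert_of_mem_vacated (D.point_mem j) (inl_mem_vertexSet_addEdge.1 hx) h.symm).elim
    · exact (ne_vert_of_mem_vacated (D.point_mem i) (inl_mem_vertexSet_addEdge.1 hy) h).elim
    · exact congrArg _ (D.point_injective h)
  arc_ends := by
    rintro (f | i) hf
    · obtain ⟨hf, hfc⟩ := inl_mem_edgeSet_addEdge.1 hf
      obtain ⟨x, y, h, h0, h1⟩ := φ.arc_ends f hf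
      exact ⟨.inl x, .inl y, ⟨hfc, x, y, h, rfl, rfl⟩, h0, h1⟩
    · exact D.exists_isLink (inr_mem_edgeSet_addEdge.1 hf)
  arc_injOn := by
    rintro (f | i) hf
    · exact φ.arc_injOn f (inl_mem_edgeSet_addEdge.1 hf).1
    · exact (D.isArcThrough _ (D.arc_mem (inr_mem_edgeSet_addEdge.1 hf))).injOn
  arc_ne_vert := by
    rintro (f | i) hf t ht (x | j) hx h
    · exact φ.arc_ne_vert f (inl_mem_edgeSet_addEdge.1 hf).1 t ht x
        (inl_mem_vertexSet_addEdge.1 hx) h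
    · exact disjoint_left.1 (disjoint_openArc_vacated (inl_mem_edgeSet_addEdge.1 hf).1
        (inl_mem_edgeSet_addEdge.1 hf).2) ⟨t, ht, h⟩ (D.point_mem j)
    all_goals
      have hmem := (D.isArcThrough _ (D.arc_mem (inr_mem_edgeSet_addEdge.1 hf))).openArc_subset
        (mem_image_of_mem _ ht)
    · exact ne_vert_of_mem_vacated hmem.1 (inl_mem_vertexSet_addEdge.1 hx) h
    · exact hmem.2 ⟨j, h.symm⟩
  arc_disjoint := by
    rintro (e | i) he (f | j) hf hne s hs t ht h
    · exact φ.arc_disjoint e (inl_mem_edgeSet_addEdge.1 he).1 f (inl_mem_edgeSet_addEdge.1 hf).1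
        (by simpa using hne) s hs t ht h
    · exact disjoint_left.1 (D.disjoint_openArc_inl (inr_mem_edgeSet_addEdge.1 hf)
        (inl_mem_edgeSet_addEdge.1 he)) ⟨s, hs, h⟩ ⟨t, ht, rfl⟩
    · exact disjoint_left.1 (D.disjoint_openArc_inl (inr_mem_edgeSet_addEdge.1 he)
        (inl_mem_edgeSet_addEdge.1 hf)) ⟨t, ht, h.symm⟩ ⟨s, hs, rfl⟩
    · exact disjoint_left.1 (D.disjoint_openArc_arc (inr_mem_edgeSet_addEdge.1 he)
        (inr_mem_edgeSet_addEdge.1 hf) (by simpa using hne)) ⟨s, hs, h⟩ ⟨t, ht, rfl⟩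

end Graph.SpaceEmbedding.AddedArcs

theorem Graph.EdgeAddition.mem_subdivided_of_isPiece {α β : Type*} {G : Graph α β}
    (c : G.EdgeAddition) {i : ℕ} {g : β} (h : c.IsPiece (.inr i) g) : g ∈ c.subdivided := by
  cases c
  · exact h.1
  · exact h.1
  · exact h.imp (·.1) (·.1)

namespace Graph.SpaceEmbedding

variable {α β X : Type*} [TopologicalSpace X] {G : Graph α β} {φ : G.SpaceEmbedding X}
  {c : G.EdgeAddition} {e e₁ e₂ : β} {x y x₁ y₁ x₂ y₂ : α}

theorem AddedArcs.extends_toSpaceEmbedding (D : φ.AddedArcs c)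
    (h : ∀ g ∈ c.subdivided,
      range (φ.arc g) = ⋃ i ∈ {i | i < c.newEnds.length ∧ c.IsPiece (.inr i) g}, range (D.arc i)) :
    D.toSpaceEmbedding.Extends φ := by
  refine ⟨fun _ _ => rfl, fun g hg => ?_⟩
  have hinl (f : β) : c.IsPiece (.inl f) g ↔ f = g := Iff.rfl
  by_cases hgc : g ∈ c.subdivided
  · rw [h g hgc]
    ext z
    simp only [mem_iUnion, Sum.exists, mem_ofPred_eq, EdgeAddition.inl_mem_edgeSet_addEdge,
      EdgeAddition.inr_mem_edgeSet_addEdge, hinl, exists_prop, mem_sdiff]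
    exact ⟨.inr, Or.rec (fun ⟨f, ⟨hf, hfg⟩, _⟩ => (hf.2 (hfg ▸ hgc)).elim) id⟩
  · ext z
    simp only [mem_iUnion, Sum.exists, mem_ofPred_eq, EdgeAddition.inl_mem_edgeSet_addEdge,
      hinl, exists_prop, mem_sdiff]
    exact ⟨fun hz => .inl ⟨g, ⟨⟨hg, hgc⟩, rfl⟩, hz⟩, Or.rec (fun ⟨_, ⟨_, hfg⟩, hz⟩ => hfg ▸ hz)
      fun ⟨i, hi, _⟩ => (hgc (c.mem_subdivided_of_isPiece hi.2)).elim⟩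

variable (φ) in
/-- A curve through a face of `φ` that joins inner points of the edges `e` and `f`. -/
def HasChord (e f : β) : Prop :=
  ∃ p ∈ openArc (φ.arc e), ∃ q ∈ openArc (φ.arc f), p ≠ q ∧
    ∃ γ : Path p q, IsArcThrough φ.imageᶜ γ

variable (φ) in
/-- A curve through a face of `φ` from an inner point of the edge `e` to a point of the face,
together with a loop at that point. -/
def HasLollipop (e : β) : Prop :=
  ∃ p ∈ openArc (φ.arc e), ∃ q ∈ φ.imageᶜ, ∃ (γ : Path p q) (l : Path q q),
    IsArcThrough (φ.imageᶜ \ {q}) γ ∧ IsArcThrough (φ.imageᶜ \ {q}) l ∧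
      Disjoint (openArc γ) (openArc l)

theorem disjoint_openArc_compl_image (he : e ∈ G.edgeSet) :
    Disjoint (openArc (φ.arc e)) φ.imageᶜ :=
  disjoint_compl_right_iff_subset.2 (φ.openArc_subset_image he)

theorem openArc_sdiff_subset_vacated (he : e ∈ G.edgeSet) (hc : e ∈ c.subdivided) {p q : X}
    (hq : q ∉ openArc (φ.arc e)) :
    openArc (φ.arc e) \ {p} ⊆ φ.vacated c \ range ![p, q] := by
  rintro z ⟨hz, hzp⟩
  refine ⟨openArc_subset_vacated he hc hz, ?_⟩
  rw [Matrix.range_cons_cons_empty]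
  rintro (h | rfl)
  exacts [hzp h, hq hz]

theorem compl_image_subset_vacated_sdiff {p q : X} (hp : p ∈ φ.image) (hq : q ∈ φ.image) :
    φ.imageᶜ ⊆ φ.vacated c \ range ![p, q] := by
  rw [Matrix.range_cons_cons_empty]
  exact subset_sdiff.2 ⟨compl_image_subset_vacated, disjoint_compl_left_iff_subset.2
    (pair_subset hp hq)⟩

theorem exists_cut {p : X} (h : G.IsLink e x y) (hp : p ∈ openArc (φ.arc e)) :
    ∃ (γ₁ : Path (φ.vert x) p) (γ₂ : Path p (φ.vert y)),
      IsArcThrough (openArc (φ.arc e) \ {p}) γ₁ ∧ IsArcThrough (openArc (φ.arc e) \ {p}) γ₂ ∧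
      Disjoint (openArc γ₁) (openArc γ₂) ∧ range γ₁ ∪ range γ₂ = range (φ.arc e) := by
  obtain ⟨γ, hγ, hopen, hrange⟩ := φ.exists_path h
  obtain ⟨γ₁, γ₂, cut⟩ := exists_isCutAt hγ (hopen ▸ hp)
  exact ⟨γ₁, γ₂, hopen ▸ cut.left, hopen ▸ cut.right, cut.disjoint, hrange ▸ cut.range_union⟩

theorem exists_addedArcs_join (h₁ : G.IsLink e₁ x₁ y₁) (h₂ : G.IsLink e₂ x₂ y₂) (hne : e₁ ≠ e₂)
    (h : φ.HasChord e₁ e₂) :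
    ∃ D : φ.AddedArcs (.join e₁ x₁ y₁ h₁ e₂ x₂ y₂ h₂ hne),
      range (D.arc 0) ∪ range (D.arc 1) = range (φ.arc e₁) ∧
      range (D.arc 2) ∪ range (D.arc 3) = range (φ.arc e₂) := by
  obtain ⟨p, hp, q, hq, hpq, γ, hγ⟩ := h
  obtain ⟨a₁, a₂, ha₁, ha₂, ha, ha_union⟩ := exists_cut h₁ hp
  obtain ⟨b₁, b₂, hb₁, hb₂, hb, hb_union⟩ := exists_cut h₂ hq
  let c : G.EdgeAddition := .join e₁ x₁ y₁ h₁ e₂ x₂ y₂ h₂ hne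
  have hc₁ : e₁ ∈ c.subdivided := .inl rfl
  have hc₂ : e₂ ∈ c.subdivided := .inr rfl
  have hab := φ.disjoint_openArc h₁.edge_mem h₂.edge_mem hne
  have hsub₁ := openArc_sdiff_subset_vacated h₁.edge_mem hc₁ (p := p) (disjoint_right.1 hab hq)
  have hsub₂ := openArc_sdiff_subset_vacated h₂.edge_mem hc₂ (p := q) (disjoint_left.1 hab hp)
  rw [Matrix.range_cons_cons_empty, pair_comm, ← Matrix.range_cons_cons_empty (u := ![])] at hsub₂
  have hγ' := hγ.mono (compl_image_subset_vacated_sdiff (c := c)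
    (φ.openArc_subset_image h₁.edge_mem hp) (φ.openArc_subset_image h₂.edge_mem hq))
  refine ⟨⟨![p, q], [a₁, a₂, b₁, b₂, γ], injective_pair_iff_ne.2 hpq, Fin.forall_fin_two.2
      ⟨openArc_subset_vacated h₁.edge_mem hc₁ hp, openArc_subset_vacated h₂.edge_mem hc₂ hq⟩,
      .cons ⟨_, _, rfl, a₁.source, a₁.target⟩ <| .cons ⟨_, _, rfl, a₂.source, a₂.target⟩ <|
      .cons ⟨_, _, rfl, b₁.source, b₁.target⟩ <| .cons ⟨_, _, rfl, b₂.source, b₂.target⟩ <|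
      .cons ⟨_, _, rfl, γ.source, γ.target⟩ .nil, ?_, ?_⟩, ha_union, hb_union⟩
  · simp only [List.forall_mem_cons, List.not_mem_nil]
    exact ⟨ha₁.mono hsub₁, ha₂.mono hsub₁, hb₁.mono hsub₂, hb₂.mono hsub₂, hγ', nofun⟩
  · have ha₁ := ha₁.openArc_subset.trans sdiff_subset
    have ha₂ := ha₂.openArc_subset.trans sdiff_subset
    have hb₁ := hb₁.openArc_subset.trans sdiff_subset
    have hb₂ := hb₂.openArc_subset.trans sdiff_subset
    have haγ := (disjoint_openArc_compl_image h₁.edge_mem).mono_right hγ.openArc_subset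
    have hbγ := (disjoint_openArc_compl_image h₂.edge_mem).mono_right hγ.openArc_subset
    simp only [List.pairwise_cons, List.forall_mem_cons, List.not_mem_nil]
    exact ⟨⟨ha, hab.mono ha₁ hb₁, hab.mono ha₁ hb₂, haγ.mono_left ha₁, nofun⟩,
      ⟨hab.mono ha₂ hb₁, hab.mono ha₂ hb₂, haγ.mono_left ha₂, nofun⟩,
      ⟨hb, hbγ.mono_left hb₁, nofun⟩, ⟨hbγ.mono_left hb₂, nofun⟩, nofun, .nil⟩

theorem exists_extends_join (h₁ : G.IsLink e₁ x₁ y₁) (h₂ : G.IsLink e₂ x₂ y₂) (hne : e₁ ≠ e₂)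
    (h : φ.HasChord e₁ e₂) :
    ∃ ψ : (G.addEdge (.join e₁ x₁ y₁ h₁ e₂ x₂ y₂ h₂ hne)).SpaceEmbedding X, ψ.Extends φ := by
  obtain ⟨D, hD₁, hD₂⟩ := exists_addedArcs_join h₁ h₂ hne h
  let c : G.EdgeAddition := .join e₁ x₁ y₁ h₁ e₂ x₂ y₂ h₂ hne
  have pieces₁ : {i | i < c.newEnds.length ∧ c.IsPiece (.inr i) e₁} = {0, 1} := by
    ext i
    simp only [c, EdgeAddition.newEnds, EdgeAddition.IsPiece, List.length_cons, List.length_nil,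
      mem_ofPred_eq, hne, mem_insert_iff, mem_singleton_iff]
    lia
  have pieces₂ : {i | i < c.newEnds.length ∧ c.IsPiece (.inr i) e₂} = {2, 3} := by
    ext i
    simp only [c, EdgeAddition.newEnds, EdgeAddition.IsPiece, List.length_cons, List.length_nil,
      mem_ofPred_eq, hne.symm, mem_insert_iff, mem_singleton_iff]
    lia
  refine ⟨D.toSpaceEmbedding, D.extends_toSpaceEmbedding ?_⟩
  rintro g (hg | hg) <;> rw [hg]
  · rw [pieces₁, biUnion_pair, hD₁]
  · rw [pieces₂, biUnion_pair, hD₂]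

theorem HasChord.exists_isCutAt (h : φ.HasChord e e) {γ : Path (φ.vert x) (φ.vert y)}
    (hγ : InjOn γ (Ioo 0 1)) (hopen : openArc γ = openArc (φ.arc e)) :
    ∃ p ∈ openArc γ, ∃ q ∈ openArc γ, p ≠ q ∧ ∃ δ : Path p q, IsArcThrough φ.imageᶜ δ ∧
      ∃ γ₁ γ₂ γ₂₁ γ₂₂, IsCutAt γ p γ₁ γ₂ ∧ IsCutAt γ₂ q γ₂₁ γ₂₂ := by
  obtain ⟨p, hp, q, hq, hpq, δ, hδ⟩ := h
  rw [← hopen] at hp hq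
  obtain hcuts | hcuts := exists_isCutAt_isCutAt hγ hp hq hpq
  · exact ⟨p, hp, q, hq, hpq, δ, hδ, hcuts⟩
  · exact ⟨q, hq, p, hp, hpq.symm, δ.symm, hδ.symm, hcuts⟩

theorem nonempty_addedArcs_parallel (h : G.IsLink e x y) (hchord : φ.HasChord e e) :
    Nonempty (φ.AddedArcs (.parallel e x y h)) := by
  obtain ⟨γ, hγ, hopen, -⟩ := φ.exists_path h
  obtain ⟨p, hp, q, hq, hpq, δ, hδ, γ₁, γ₂, γ₂₁, γ₂₂, cut, cut'⟩ := hchord.exists_isCutAt hγ hopen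
  let c : G.EdgeAddition := .parallel e x y h
  have hc : e ∈ c.subdivided := rfl
  have hdisj := disjoint_openArc_compl_image (φ := φ) h.edge_mem
  rw [← hopen] at hdisj
  have hsub : openArc γ \ {p, q} ⊆ φ.vacated c \ range ![p, q] := by
    rw [Matrix.range_cons_cons_empty, hopen]
    exact sdiff_subset_sdiff_left (openArc_subset_vacated h.edge_mem hc)
  have hsub₁ := cut.openArc_left_subset cut'.mem
  have hsub₂ : openArc γ₂ \ {q} ⊆ openArc γ \ {p, q} := by
    rw [insert_eq, ← sdiff_sdiff]
    exact sdiff_subset_sdiff_left cut.right.openArc_subset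
  have hδ' := hδ.mono (compl_image_subset_vacated_sdiff (c := c)
    (φ.openArc_subset_image h.edge_mem (hopen ▸ hp))
    (φ.openArc_subset_image h.edge_mem (hopen ▸ hq)))
  have h₂₁ := cut'.left.openArc_subset.trans sdiff_subset
  have h₂₂ := cut'.right.openArc_subset.trans sdiff_subset
  have hdisj₁ := hdisj.mono (hsub₁.trans sdiff_subset) hδ.openArc_subset
  have hdisj₂ := hdisj.mono (cut.right.openArc_subset.trans sdiff_subset) hδ.openArc_subset
  rw [hopen] at hp hq
  refine ⟨⟨![p, q], [γ₁, γ₂₁, γ₂₂, δ], injective_pair_iff_ne.2 hpq, Fin.forall_fin_two.2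
      ⟨openArc_subset_vacated h.edge_mem hc hp, openArc_subset_vacated h.edge_mem hc hq⟩,
      .cons ⟨_, _, rfl, γ₁.source, γ₁.target⟩ <| .cons ⟨_, _, rfl, γ₂₁.source, γ₂₁.target⟩ <|
      .cons ⟨_, _, rfl, γ₂₂.source, γ₂₂.target⟩ <| .cons ⟨_, _, rfl, δ.source, δ.target⟩ .nil,
      ?_, ?_⟩⟩
  · simp only [List.forall_mem_cons, List.not_mem_nil]
    exact ⟨⟨cut.left.injOn, hsub₁.trans hsub⟩, cut'.left.mono (hsub₂.trans hsub),
      cut'.right.mono (hsub₂.trans hsub), hδ', nofun⟩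
  · simp only [List.pairwise_cons, List.forall_mem_cons, List.not_mem_nil]
    exact ⟨⟨cut.disjoint.mono_right h₂₁, cut.disjoint.mono_right h₂₂, hdisj₁, nofun⟩,
      ⟨cut'.disjoint, hdisj₂.mono_left h₂₁, nofun⟩, ⟨hdisj₂.mono_left h₂₂, nofun⟩, nofun, .nil⟩

theorem nonempty_addedArcs_lollipop (h : G.IsLink e x y) (hl : φ.HasLollipop e) :
    Nonempty (φ.AddedArcs (.lollipop e x y h)) := by
  obtain ⟨p, hp, q, hq, γ, l, hγ, hl, hγl⟩ := hl
  obtain ⟨a₁, a₂, ha₁, ha₂, ha, -⟩ := exists_cut h hp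
  let c : G.EdgeAddition := .lollipop e x y h
  have hc : e ∈ c.subdivided := rfl
  have hdisj := disjoint_openArc_compl_image (φ := φ) h.edge_mem
  have hsub := openArc_sdiff_subset_vacated h.edge_mem hc (p := p) (disjoint_right.1 hdisj hq)
  have hsub' : φ.imageᶜ \ {q} ⊆ φ.vacated c \ range ![p, q] := by
    rw [Matrix.range_cons_cons_empty, insert_eq, ← sdiff_sdiff]
    exact sdiff_subset_sdiff_left (subset_sdiff_singleton compl_image_subset_vacated
      (disjoint_left.1 hdisj hp))
  have hdisj' := hdisj.mono_right (sdiff_subset (t := {q}))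
  refine ⟨⟨![p, q], [a₁, a₂, γ, l], injective_pair_iff_ne.2 (hdisj.ne_of_mem hp hq),
      Fin.forall_fin_two.2 ⟨openArc_subset_vacated h.edge_mem hc hp,
        compl_image_subset_vacated hq⟩,
      .cons ⟨_, _, rfl, a₁.source, a₁.target⟩ <| .cons ⟨_, _, rfl, a₂.source, a₂.target⟩ <|
      .cons ⟨_, _, rfl, γ.source, γ.target⟩ <| .cons ⟨_, _, rfl, l.source, l.target⟩ .nil,
      ?_, ?_⟩⟩
  · simp only [List.forall_mem_cons, List.not_mem_nil]
    exact ⟨ha₁.mono hsub, ha₂.mono hsub, hγ.mono hsub', hl.mono hsub', nofun⟩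
  · have ha₁ := ha₁.openArc_subset.trans sdiff_subset
    have ha₂ := ha₂.openArc_subset.trans sdiff_subset
    simp only [List.pairwise_cons, List.forall_mem_cons, List.not_mem_nil]
    exact ⟨⟨ha, hdisj'.mono ha₁ hγ.openArc_subset, hdisj'.mono ha₁ hl.openArc_subset, nofun⟩,
      ⟨hdisj'.mono ha₂ hγ.openArc_subset, hdisj'.mono ha₂ hl.openArc_subset, nofun⟩,
      ⟨hγl, nofun⟩, nofun, .nil⟩

end Graph.SpaceEmbedding

section SignedArea

variable {R : Type*} [CommRing R]

/-- Twice the signed area of the triangle with vertices `p`, `q`, `z`, as an affine function of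
`z`. It is positive to the left of the line from `p` to `q`. -/
def signedArea (p q : R × R) : R × R →ᵃ[R] R where
  toFun z := (q.1 - p.1) * (z.2 - p.2) - (q.2 - p.2) * (z.1 - p.1)
  linear := (q.1 - p.1) • LinearMap.snd R R R - (q.2 - p.2) • LinearMap.fst R R R
  map_vadd' z v := by
    simp only [vadd_eq_add, Prod.fst_add, Prod.snd_add, LinearMap.sub_apply, LinearMap.smul_apply,
      LinearMap.snd_apply, LinearMap.fst_apply, smul_eq_mul]
    ring

theorem signedArea_apply (p q z : R × R) :
    signedArea p q z = (q.1 - p.1) * (z.2 - p.2) - (q.2 - p.2) * (z.1 - p.1) :=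
  rfl

@[simp] theorem signedArea_left (p q : R × R) : signedArea p q p = 0 := by
  simp only [signedArea_apply]; ring

@[simp] theorem signedArea_right (p q : R × R) : signedArea p q q = 0 := by
  simp only [signedArea_apply]; ring

theorem signedArea_rotate (p q r : R × R) : signedArea q r p = signedArea p q r := by
  simp only [signedArea_apply]; ring

theorem signedArea_smul_sub (p q r z : R × R) :
    signedArea p q r • (z - q) =
      signedArea q r z • (p - q) + signedArea p q z • (r - q) := by
  ext <;> simp only [signedArea_apply, Prod.smul_fst, Prod.smul_snd, Prod.fst_sub, Prod.snd_sub,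
    Prod.fst_add, Prod.snd_add, smul_eq_mul] <;> ring

end SignedArea

section Polygon

/-- The points `v 0, …, v (n - 1)` are the corners, in counterclockwise order, of a strictly convex
polygon. -/
def IsConvexPolygon {R : Type*} [CommRing R] [LT R] {n : ℕ} [NeZero n] (v : Fin n → R × R) : Prop :=
  3 ≤ n ∧ ∀ i j, j ≠ i → j ≠ i + 1 → 0 < signedArea (v i) (v (i + 1)) (v j)

/-- The interior of the polygon with corners `v`. -/
def openPolygon {n : ℕ} [NeZero n] (v : Fin n → ℝ × ℝ) : Set (ℝ × ℝ) :=
  {z | ∀ i, 0 < signedArea (v i) (v (i + 1)) z}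

variable {n : ℕ} [NeZero n] {v : Fin n → ℝ × ℝ}

theorem isOpen_openPolygon : IsOpen (openPolygon v) := by
  simp only [openPolygon, ofPred_forall]
  exact isOpen_iInter_of_finite fun i => isOpen_Ioi.preimage
    (signedArea (v i) (v (i + 1))).continuous_of_finiteDimensional

theorem convex_openPolygon : Convex ℝ (openPolygon v) := by
  simp only [openPolygon, ofPred_forall]
  exact convex_iInter fun i => (convex_Ioi 0).affine_preimage (signedArea (v i) (v (i + 1)))

namespace IsConvexPolygon

theorem add_one_add_one_ne (hv : IsConvexPolygon v) (i : Fin n) : i + 1 + 1 ≠ i := by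
  obtain ⟨k, rfl⟩ := Nat.exists_eq_add_of_le' hv.1
  rw [add_assoc, Ne, add_eq_left]
  exact Fin.ne_of_val_ne (by simp [Fin.val_add, Nat.mod_eq_of_lt])

theorem add_one_ne (hv : IsConvexPolygon v) (i : Fin n) : i + 1 ≠ i := by
  obtain ⟨k, rfl⟩ := Nat.exists_eq_add_of_le' hv.1
  simp

theorem signedArea_add_one_add_one_pos (hv : IsConvexPolygon v) (i : Fin n) :
    0 < signedArea (v i) (v (i + 1)) (v (i + 1 + 1)) :=
  hv.2 i _ (hv.add_one_add_one_ne i) (hv.add_one_ne (i + 1))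

theorem signedArea_nonneg (hv : IsConvexPolygon v) (i j : Fin n) :
    0 ≤ signedArea (v i) (v (i + 1)) (v j) := by
  by_cases h : j = i
  · simp [h]
  by_cases h' : j = i + 1
  · simp [h']
  exact (hv.2 i j h h').le

theorem openPolygon_nonempty (hv : IsConvexPolygon v) : (openPolygon v).Nonempty := by
  refine ⟨Finset.univ.centroid ℝ v, fun i => ?_⟩
  have hn : (0 : ℝ) < n := Nat.cast_pos.2 (NeZero.pos n)
  rw [Finset.centroid_def, Finset.map_affineCombination _ _ _
    (Finset.sum_centroidWeights_eq_one_of_nonempty _ _ Finset.univ_nonempty),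
    Finset.affineCombination_eq_linear_combination _ _ _
    (Finset.sum_centroidWeights_eq_one_of_nonempty _ _ Finset.univ_nonempty)]
  refine Finset.sum_pos' (fun j _ => ?_) ⟨i + 1 + 1, Finset.mem_univ _, ?_⟩
  · have := hv.signedArea_nonneg i j
    simp only [Finset.centroidWeights_apply, Function.comp_apply, smul_eq_mul]
    positivity
  · have := hv.signedArea_add_one_add_one_pos i
    simp only [Finset.centroidWeights_apply, Finset.card_univ, Fintype.card_fin,
      Function.comp_apply, smul_eq_mul]
    positivity

theorem setOf_nonneg_subset_convexHull (hv : IsConvexPolygon v) :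
    {z | ∀ i, 0 ≤ signedArea (v i) (v (i + 1)) z} ⊆ convexHull ℝ (range v) := by
  intro z hz
  by_contra hzv
  obtain ⟨f, u, hfz, hf⟩ := geometric_hahn_banach_point_closed (convex_convexHull ℝ (range v))
    ((finite_range v).isClosed_convexHull ℝ) hzv
  obtain ⟨j, hj⟩ := Finite.exists_min (f ∘ v)
  obtain ⟨i, rfl⟩ : ∃ i, i + 1 = j := ⟨j - 1, sub_add_cancel j 1⟩
  have hcone := congrArg f (signedArea_smul_sub (v i) (v (i + 1)) (v (i + 1 + 1)) z)
  simp only [map_add, map_smul, map_sub, smul_eq_mul] at hcone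
  have h₀ := mul_nonneg (hz (i + 1)) (sub_nonneg.2 (hj i))
  have h₂ := mul_nonneg (hz i) (sub_nonneg.2 (hj (i + 1 + 1)))
  have hle : 0 ≤ f z - f (v (i + 1)) := nonneg_of_mul_nonneg_right
    (hcone ▸ add_nonneg h₀ h₂) (hv.signedArea_add_one_add_one_pos i)
  linarith [hf _ (subset_convexHull ℝ _ (mem_range_self (i + 1)))]

theorem closure_openPolygon (hv : IsConvexPolygon v) :
    closure (openPolygon v) = {z | ∀ i, 0 ≤ signedArea (v i) (v (i + 1)) z} := by
  refine subset_antisymm (closure_minimal (fun z hz i => (hz i).le) ?_) fun z hz => ?_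
  · simp only [ofPred_forall]
    exact isClosed_iInter fun i => isClosed_Ici.preimage
      (signedArea (v i) (v (i + 1))).continuous_of_finiteDimensional
  · obtain ⟨c, hc⟩ := hv.openPolygon_nonempty
    have hsub : openSegment ℝ c z ⊆ openPolygon v := by
      rintro _ ⟨a, b, ha, hb, hab, rfl⟩ i
      rw [Convex.combo_affine_apply hab]
      exact add_pos_of_pos_of_nonneg (smul_pos ha (hc i)) (smul_nonneg hb.le (hz i))
    exact closure_mono hsub (segment_subset_closure_openSegment (right_mem_segment ℝ c z))

theorem closure_openPolygon_subset (hv : IsConvexPolygon v) :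
    closure (openPolygon v) ⊆ convexHull ℝ (range v) :=
  hv.closure_openPolygon.trans_subset hv.setOf_nonneg_subset_convexHull

theorem mem_segment_of_signedArea_eq_zero (hv : IsConvexPolygon v) {z : ℝ × ℝ}
    (hz : ∀ j, 0 ≤ signedArea (v j) (v (j + 1)) z) {i : Fin n}
    (hzi : signedArea (v i) (v (i + 1)) z = 0) : z ∈ segment ℝ (v i) (v (i + 1)) := by
  obtain ⟨k, rfl⟩ : ∃ k, k + 1 = i := ⟨i - 1, sub_add_cancel i 1⟩
  have hr := hv.signedArea_add_one_add_one_pos (k + 1)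
  have hq := hv.signedArea_add_one_add_one_pos k
  set p := v (k + 1)
  set q := v (k + 1 + 1)
  set r := v (k + 1 + 1 + 1)
  have hcone := signedArea_smul_sub p q r z
  obtain ⟨t, rfl⟩ : ∃ t : ℝ, AffineMap.lineMap q p t = z := by
    refine ⟨(signedArea p q r)⁻¹ * signedArea q r z, ?_⟩
    rw [AffineMap.lineMap_apply, vsub_eq_sub, mul_smul, vadd_eq_add, ← eq_sub_iff_add_eq,
      inv_smul_eq_iff₀ hr.ne', hcone, hzi, zero_smul, add_zero]
  have ht : 0 ≤ t := by
    have := hz (k + 1 + 1)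
    rw [AffineMap.apply_lineMap, signedArea_left, signedArea_rotate,
      AffineMap.lineMap_apply_ring, mul_zero, zero_add] at this
    exact nonneg_of_mul_nonneg_left this hr
  have ht' : t ≤ 1 := by
    have := hz k
    rw [AffineMap.apply_lineMap, signedArea_right, AffineMap.lineMap_apply_ring, mul_zero,
      add_zero] at this
    exact sub_nonneg.1 (nonneg_of_mul_nonneg_left this hq)
  rw [segment_symm, segment_eq_image_lineMap]
  exact mem_image_of_mem _ ⟨ht, ht'⟩

theorem segment_subset_closure_openPolygon (hv : IsConvexPolygon v) (i : Fin n) :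
    segment ℝ (v i) (v (i + 1)) ⊆ closure (openPolygon v) := by
  refine convex_openPolygon.closure.segment_subset ?_ ?_ <;>
  · rw [hv.closure_openPolygon]
    exact fun j => hv.signedArea_nonneg j _

theorem frontier_openPolygon (hv : IsConvexPolygon v) :
    frontier (openPolygon v) = ⋃ i, segment ℝ (v i) (v (i + 1)) := by
  rw [isOpen_openPolygon.frontier_eq]
  ext z
  simp only [mem_sdiff, mem_iUnion]
  constructor
  · rintro ⟨hz, hzv⟩
    simp only [openPolygon, mem_ofPred_eq, not_forall, not_lt] at hzv
    obtain ⟨i, hi⟩ := hzv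
    rw [hv.closure_openPolygon] at hz
    exact ⟨i, hv.mem_segment_of_signedArea_eq_zero hz (hi.antisymm (hz i))⟩
  · rintro ⟨i, hz⟩
    refine ⟨hv.segment_subset_closure_openPolygon i hz, fun hzv => (hzv i).ne' ?_⟩
    obtain ⟨a, b, -, -, hab, rfl⟩ := hz
    simp [Convex.combo_affine_apply hab]

end IsConvexPolygon
end Polygon

theorem nontrivial_openArc {X : Type*} {S : Set X} {a : unitInterval → X} (h : IsArcThrough S a) :
    (openArc a).Nontrivial :=
  (Ioo_infinite zero_lt_one).nontrivial.image_of_injOn h.injOn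

namespace Graph.SpaceEmbedding

variable {α β X : Type*} [TopologicalSpace X] {G : Graph α β} {φ : G.SpaceEmbedding X} {e f : β}

theorem isArcThrough_univ_arc (he : e ∈ G.edgeSet) : IsArcThrough univ (φ.arc e) :=
  ⟨φ.arc_injOn e he, subset_univ _⟩

theorem isFace_of_frontier_subset {W : Set X} (hne : W.Nonempty) (hopen : IsOpen W)
    (hconn : IsPreconnected W) (hdisj : Disjoint W φ.image) (hfr : frontier W ⊆ φ.image) :
    φ.IsFace W := by
  obtain ⟨p, hp⟩ := hne
  have hW : W ⊆ φ.imageᶜ := subset_compl_iff_disjoint_right.2 hdisj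
  refine ⟨p, hW hp, (hconn.subset_connectedComponentIn hp hW).antisymm ?_⟩
  refine isPreconnected_connectedComponentIn.subset_of_closure_inter_subset hopen
    ⟨p, mem_connectedComponentIn (hW hp), hp⟩ ?_
  rintro z ⟨hz, hzC⟩
  by_contra hzW
  exact connectedComponentIn_subset _ _ hzC (hfr (hopen.frontier_eq ▸ ⟨hz, hzW⟩))

variable {E : Type*} [AddCommGroup E] [Module ℝ E] [TopologicalSpace E]

variable (φ) in
/-- The map `π` takes the open convex set `U` bijectively onto a part of a face of `φ`. -/
structure IsConvexRegion (π : E → X) (U : Set E) : Prop where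
  continuous : Continuous π
  isOpen : IsOpen U
  nonempty : U.Nonempty
  convex : Convex ℝ U
  injOn : InjOn π U
  disjoint : Disjoint (π '' U) φ.image

namespace IsConvexRegion

variable {π : E → X} {U : Set E}

theorem isArcThrough_map (h : φ.IsConvexRegion π U) {P Q : E} {γ : Path P Q}
    (hγ : IsArcThrough U γ) : IsArcThrough φ.imageᶜ (γ.map h.continuous) :=
  (hγ.comp h.injOn).mono (subset_compl_iff_disjoint_right.2 h.disjoint)

variable [IsTopologicalAddGroup E] [ContinuousSMul ℝ E]

theorem hasChord (h : φ.IsConvexRegion π U) (hE : 1 < Module.rank ℝ E)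
    (he : openArc (φ.arc e) ⊆ π '' closure U) (hf : openArc (φ.arc f) ⊆ π '' closure U)
    (heG : e ∈ G.edgeSet) (hfG : f ∈ G.edgeSet) : φ.HasChord e f := by
  obtain ⟨p, hp⟩ := (nontrivial_openArc (φ.isArcThrough_univ_arc heG)).nonempty
  obtain ⟨q, hq, hqp⟩ := (nontrivial_openArc (φ.isArcThrough_univ_arc hfG)).exists_ne p
  obtain ⟨P, hP, rfl⟩ := he hp
  obtain ⟨Q, hQ, rfl⟩ := hf hq
  obtain ⟨γ, hγ⟩ := exists_path_isArcThrough hE h.isOpen h.nonempty h.convex hP hQ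
    (ne_of_apply_ne π hqp).symm
  exact ⟨π P, hp, π Q, hq, hqp.symm, γ.map h.continuous, h.isArcThrough_map hγ⟩

theorem hasLollipop (h : φ.IsConvexRegion π U) (hE : 1 < Module.rank ℝ E)
    (he : openArc (φ.arc e) ⊆ π '' closure U) (heG : e ∈ G.edgeSet) : φ.HasLollipop e := by
  obtain ⟨p, hp⟩ := (nontrivial_openArc (φ.isArcThrough_univ_arc heG)).nonempty
  obtain ⟨P, hP, rfl⟩ := he hp
  obtain ⟨q, hq⟩ := h.nonempty
  have hU : π '' U ⊆ φ.imageᶜ := subset_compl_iff_disjoint_right.2 h.disjoint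
  have hqU : π q ∈ φ.imageᶜ := hU (mem_image_of_mem π hq)
  have hPq : P ≠ q := by
    rintro rfl
    exact hqU (φ.openArc_subset_image heG hp)
  have hsub : π '' (U \ {q}) ⊆ φ.imageᶜ \ {π q} := by
    rw [h.injOn.image_sdiff_subset (singleton_subset_iff.2 hq), image_singleton]
    exact sdiff_subset_sdiff_left hU
  obtain ⟨γ, l, hγ, hl, hγl⟩ := exists_path_loop_isArcThrough hE h.isOpen h.convex hP hq hPq
  have hinj : InjOn π (U \ {q}) := h.injOn.mono sdiff_subset
  refine ⟨π P, hp, π q, hqU, γ.map h.continuous, l.map h.continuous,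
    (hγ.comp hinj).mono hsub, (hl.comp hinj).mono hsub, ?_⟩
  have hdisj := hγl.image hinj hγ.openArc_subset hl.openArc_subset
  rwa [openArc, openArc, image_image, image_image] at hdisj

theorem isFace (h : φ.IsConvexRegion π U) (hπ : IsOpenMap π)
    (hfr : frontier (π '' U) ⊆ φ.image) : φ.IsFace (π '' U) :=
  isFace_of_frontier_subset (h.nonempty.image π) (hπ U h.isOpen)
    (h.convex.isPreconnected.image π h.continuous.continuousOn) h.disjoint hfr

end IsConvexRegion

end Graph.SpaceEmbedding

section Separation

theorem disjoint_openSegment_segment {E : Type*} [AddCommGroup E] [Module ℝ E] {f : E →ᵃ[ℝ] ℝ}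
    {p q p' q' : E} (hp : 0 ≤ f p) (hq : 0 ≤ f q) (hp' : f p' ≤ 0) (hq' : f q' ≤ 0)
    (h : 0 < f p + f q ∨ f p' < 0 ∧ f q' < 0) :
    Disjoint (openSegment ℝ p q) (segment ℝ p' q') := by
  rw [disjoint_left]
  rintro _ ⟨a, b, ha, hb, hab, rfl⟩ ⟨a', b', ha', hb', hab', he⟩
  have hfe := congrArg f he
  rw [Convex.combo_affine_apply hab, Convex.combo_affine_apply hab'] at hfe
  simp only [smul_eq_mul] at hfe
  have hpos : 0 ≤ a * f p + b * f q := by positivity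
  have hneg : a' * f p' + b' * f q' ≤ 0 := by
    linarith [mul_nonneg ha' (neg_nonneg.2 hp'), mul_nonneg hb' (neg_nonneg.2 hq')]
  rcases h with h | ⟨hp', hq'⟩
  · have : 0 < a * f p + b * f q := by
      rcases hp.eq_or_lt with hp | hp
      · nlinarith
      · nlinarith
    linarith
  · have hmem : a' * f p' + b' * f q' ∈ Iio (0 : ℝ) := convex_Iio 0 hp' hq' ha' hb' hab'
    exact (hfe ▸ hmem).not_ge hpos

theorem disjoint_openPolygon_convexHull {n : ℕ} [NeZero n] {v : Fin n → ℝ × ℝ} {s : Set (ℝ × ℝ)}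
    (i : Fin n) (h : ∀ z ∈ s, signedArea (v i) (v (i + 1)) z ≤ 0) :
    Disjoint (openPolygon v) (convexHull ℝ s) := by
  have hconv := (convex_Iic (0 : ℝ)).affine_preimage (signedArea (v i) (v (i + 1)))
  exact disjoint_left.2 fun z hz hzs => (hz i).not_ge (convexHull_min h hconv hzs)

end Separation

/-- The covering of the torus by the plane. -/
noncomputable def torusProj (z : ℝ × ℝ) : UnitAddTorus (Fin 2) := ![(z.1 : UnitAddCircle), z.2]

/-- The point `p / 8` of the plane. Drawings have their vertices on the grid `(1 / 8) ℤ²`, in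
which the period lattice of `torusProj` is `8 ℤ²`. -/
noncomputable def gridPoint (p : ℤ × ℤ) : ℝ × ℝ := (p.1 / 8, p.2 / 8)

/-- A square of side two in which the lifts of edges and faces of a drawing have to lie. -/
def gridBox : Set (ℝ × ℝ) := Icc (gridPoint (-4, -4)) (gridPoint (12, 12))

/-- The translations `s` for which `gridBox` meets its translate by the period `8 • s`. -/
noncomputable def boxPeriods : Finset (ℤ × ℤ) := Finset.Icc (-2) 2 ×ˢ Finset.Icc (-2) 2

theorem gridPoint_add (p q : ℤ × ℤ) : gridPoint (p + q) = gridPoint p + gridPoint q := by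
  simp [gridPoint, add_div]

theorem gridPoint_eight_smul (s : ℤ × ℤ) : gridPoint (8 • s) = (↑s.1, ↑s.2) := by
  simp [gridPoint]

theorem dist_gridPoint_lt_one {p q : ℤ × ℤ} (h₁ : |p.1 - q.1| < 8) (h₂ : |p.2 - q.2| < 8) :
    dist (gridPoint p) (gridPoint q) < 1 := by
  have hcoord {a b : ℤ} (h : |a - b| < 8) : dist (a / 8 : ℝ) (b / 8) < 1 := by
    rw [Real.dist_eq, ← sub_div, abs_div, abs_of_pos (by norm_num : (0 : ℝ) < 8),
      div_lt_one (by norm_num)]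
    exact_mod_cast h
  exact max_lt (hcoord h₁) (hcoord h₂)

theorem signedArea_gridPoint (p q z : ℤ × ℤ) :
    signedArea (gridPoint p) (gridPoint q) (gridPoint z) = (signedArea p q z : ℤ) / 64 := by
  simp only [signedArea_apply, gridPoint]
  push_cast
  ring

theorem signedArea_gridPoint_nonneg {p q z : ℤ × ℤ} (h : 0 ≤ signedArea p q z) :
    0 ≤ signedArea (gridPoint p) (gridPoint q) (gridPoint z) :=
  signedArea_gridPoint p q z ▸ div_nonneg (Int.cast_nonneg h) (by norm_num)

theorem signedArea_gridPoint_nonpos {p q z : ℤ × ℤ} (h : signedArea p q z ≤ 0) :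
    signedArea (gridPoint p) (gridPoint q) (gridPoint z) ≤ 0 :=
  signedArea_gridPoint p q z ▸
    div_nonpos_of_nonpos_of_nonneg (Int.cast_nonpos.2 h) (by norm_num)

theorem gridPoint_injective : Function.Injective gridPoint := fun p q h => by
  simpa [gridPoint, Prod.ext_iff] using h

theorem gridPoint_mem_gridBox {p : ℤ × ℤ} (hp : p ∈ Icc (-4, -4) (12, 12)) :
    gridPoint p ∈ gridBox := by
  have hmono : Monotone gridPoint := fun a b h => by
    have h₁ : (a.1 : ℝ) ≤ b.1 := Int.cast_le.2 h.1
    have h₂ : (a.2 : ℝ) ≤ b.2 := Int.cast_le.2 h.2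
    constructor <;> simp only [gridPoint] <;> gcongr
  exact hmono.mapsTo_Icc hp

theorem one_lt_rank_real_prod : 1 < Module.rank ℝ (ℝ × ℝ) := by
  rw [rank_prod', Module.rank_self, one_add_one_eq_two]
  exact Cardinal.one_lt_two

theorem convex_gridBox : Convex ℝ gridBox := convex_Icc _ _

theorem torusProj_eq_iff {z w : ℝ × ℝ} :
    torusProj z = torusProj w ↔ ∃ s : ℤ × ℤ, z = gridPoint (8 • s) + w := by
  have hcoe (x y : ℝ) : (x : UnitAddCircle) = y ↔ ∃ m : ℤ, m + y = x := by
    rw [← sub_eq_zero, ← AddCircle.coe_sub, AddCircle.coe_eq_zero_iff]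
    simp only [zsmul_one, eq_sub_iff_add_eq]
  simp only [torusProj, funext_iff, Fin.forall_fin_two, Matrix.cons_val_zero, Matrix.cons_val_one,
    hcoe, gridPoint_eight_smul, Prod.ext_iff, Prod.exists, exists_and_left, exists_and_right,
    Prod.fst_add, Prod.snd_add, eq_comm]

theorem torusProj_gridPoint_eq_iff {p q : ℤ × ℤ} :
    torusProj (gridPoint p) = torusProj (gridPoint q) ↔ ∃ s : ℤ × ℤ, p = 8 • s + q := by
  simp only [torusProj_eq_iff, ← gridPoint_add, gridPoint_injective.eq_iff]

theorem torusProj_vadd (s : ℤ × ℤ) (z : ℝ × ℝ) : torusProj (gridPoint (8 • s) +ᵥ z) = torusProj z :=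
  torusProj_eq_iff.2 ⟨s, rfl⟩

@[fun_prop]
theorem continuous_torusProj : Continuous torusProj := by
  refine continuous_pi (Fin.forall_fin_two.2 ⟨?_, ?_⟩)
  · exact (AddCircle.continuous_mk' 1).comp continuous_fst
  · exact (AddCircle.continuous_mk' 1).comp continuous_snd

theorem isOpenMap_torusProj : IsOpenMap torusProj := by
  have h : IsOpenMap fun (f : Fin 2 → ℝ) i => (f i : UnitAddCircle) :=
    IsOpenMap.piMap (fun _ => QuotientAddGroup.isOpenMap_coe) (by simp)
  convert h.comp Homeomorph.finTwoArrow.symm.isOpenMap using 1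
  ext z i
  fin_cases i <;> rfl

theorem eq_of_torusProj_eq_of_dist_lt_one {z w : ℝ × ℝ} (h : torusProj z = torusProj w)
    (hd : dist z w < 1) : z = w := by
  obtain ⟨s, rfl⟩ := torusProj_eq_iff.1 h
  rw [dist_eq_norm, add_sub_cancel_right, gridPoint_eight_smul, Prod.norm_def, max_lt_iff] at hd
  simp only [Real.norm_eq_abs] at hd
  have h₁ : |s.1| < 1 := by exact_mod_cast hd.1
  have h₂ : |s.2| < 1 := by exact_mod_cast hd.2
  rw [gridPoint_eight_smul, Int.abs_lt_one_iff.1 h₁, Int.abs_lt_one_iff.1 h₂]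
  simp

theorem mem_boxPeriods {s : ℤ × ℤ} {z : ℝ × ℝ} (hz : z ∈ gridBox)
    (hs : gridPoint (8 • s) + z ∈ gridBox) : s ∈ boxPeriods := by
  have hbound {m : ℤ} {x : ℝ} (hx : x ∈ Icc (-4 / 8) (12 / 8))
      (hm : m + x ∈ Icc (-4 / 8 : ℝ) (12 / 8)) : m ∈ Finset.Icc (-2) 2 := by
    rw [Finset.mem_Icc, ← Int.cast_le (R := ℝ), ← Int.cast_le (R := ℝ)]
    push_cast
    constructor <;> linarith [hx.1, hx.2, hm.1, hm.2]
  rw [gridPoint_eight_smul] at hs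
  simp only [gridBox, gridPoint, Icc_prod_eq, mem_prod, Prod.fst_add, Prod.snd_add] at hz hs
  push_cast at hz hs
  exact Finset.mem_product.2 ⟨hbound hz.1 hs.1, hbound hz.2 hs.2⟩

theorem disjoint_image_torusProj {S T : Set (ℝ × ℝ)} (hS : S ⊆ gridBox) (hT : T ⊆ gridBox)
    (h : ∀ s ∈ boxPeriods, Disjoint S (gridPoint (8 • s) +ᵥ T)) :
    Disjoint (torusProj '' S) (torusProj '' T) := by
  rw [disjoint_left]
  rintro _ ⟨z, hz, rfl⟩ ⟨w, hw, hzw⟩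
  obtain ⟨s, rfl⟩ := torusProj_eq_iff.1 hzw.symm
  exact disjoint_left.1 (h s (mem_boxPeriods (hT hw) (hS hz))) hz (vadd_mem_vadd_set hw)

theorem injOn_torusProj {S : Set (ℝ × ℝ)} (hS : S ⊆ gridBox)
    (h : ∀ s ∈ boxPeriods, s ≠ 0 → Disjoint S (gridPoint (8 • s) +ᵥ S)) : InjOn torusProj S := by
  intro z hz w hw hzw
  obtain ⟨s, rfl⟩ := torusProj_eq_iff.1 hzw
  by_contra hne
  have hs : s ≠ 0 := by
    rintro rfl
    simp [gridPoint] at hne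
  exact disjoint_left.1 (h s (mem_boxPeriods (hS hw) (hS hz)) hs) hz (vadd_mem_vadd_set hw)

/-- A certificate that the open segment from `p` to `q` does not meet the closed segment from `p'`
to `q'`: the line through one of them separates the two. -/
def SegmentsApart (p q p' q' : ℤ × ℤ) : Prop :=
  ∃ l ∈ [(p, q), (q, p), (p', q'), (q', p')],
    0 ≤ signedArea l.1 l.2 p ∧ 0 ≤ signedArea l.1 l.2 q ∧
    signedArea l.1 l.2 p' ≤ 0 ∧ signedArea l.1 l.2 q' ≤ 0 ∧
    (0 < signedArea l.1 l.2 p + signedArea l.1 l.2 q ∨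
      signedArea l.1 l.2 p' < 0 ∧ signedArea l.1 l.2 q' < 0)

instance (p q p' q' : ℤ × ℤ) : Decidable (SegmentsApart p q p' q') := by
  unfold SegmentsApart; infer_instance

theorem SegmentsApart.disjoint {p q p' q' : ℤ × ℤ} (h : SegmentsApart p q p' q') :
    Disjoint (openSegment ℝ (gridPoint p) (gridPoint q))
      (segment ℝ (gridPoint p') (gridPoint q')) := by
  obtain ⟨⟨a, b⟩, -, hp, hq, hp', hq', h⟩ := h
  refine disjoint_openSegment_segment
    (signedArea_gridPoint_nonneg hp) (signedArea_gridPoint_nonneg hq)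
    (signedArea_gridPoint_nonpos hp') (signedArea_gridPoint_nonpos hq') ?_
  simp only [signedArea_gridPoint]
  refine h.imp (fun h => ?_) fun h => ?_
  · rw [← add_div]
    exact div_pos (by exact_mod_cast h) (by norm_num)
  · exact ⟨div_neg_of_neg_of_pos (Int.cast_lt_zero.2 h.1) (by norm_num),
      div_neg_of_neg_of_pos (Int.cast_lt_zero.2 h.2) (by norm_num)⟩

/-- A drawing with straight edges on the torus, given by lifts of the edges to the plane, from
`gridPoint (tail k)` to `gridPoint (head k)`. -/
structure TorusDrawing (κ : Type*) where
  tail : κ → ℤ × ℤ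
  head : κ → ℤ × ℤ
  tail_mem_box : ∀ k, tail k ∈ Icc (-4, -4) (12, 12)
  head_mem_box : ∀ k, head k ∈ Icc (-4, -4) (12, 12)
  ne : ∀ k, tail k ≠ head k
  short : ∀ k, |(tail k).1 - (head k).1| < 8 ∧ |(tail k).2 - (head k).2| < 8
  apart : ∀ k l, k ≠ l → ∀ s ∈ boxPeriods,
    SegmentsApart (tail k) (head k) (8 • s + tail l) (8 • s + head l)

namespace TorusDrawing

variable {κ : Type*} (D : TorusDrawing κ)

/-- An edge of the drawing as a curve on the torus. -/
noncomputable def arc (k : κ) : C(unitInterval, UnitAddTorus (Fin 2)) :=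
  (Path.segment (gridPoint (D.tail k)) (gridPoint (D.head k))).map continuous_torusProj

/-- The points of the torus that lie on edges of the drawing. -/
def image : Set (UnitAddTorus (Fin 2)) := ⋃ k, range (D.arc k)

theorem range_arc (k : κ) :
    range (D.arc k) = torusProj '' segment ℝ (gridPoint (D.tail k)) (gridPoint (D.head k)) := by
  rw [← Path.range_segment, ← range_comp]
  rfl

theorem openArc_arc (k : κ) : openArc (D.arc k) =
    torusProj '' openSegment ℝ (gridPoint (D.tail k)) (gridPoint (D.head k)) := by
  rw [← openArc_segment, openArc, openArc, image_image]
  rfl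

theorem segment_subset_gridBox (k : κ) :
    segment ℝ (gridPoint (D.tail k)) (gridPoint (D.head k)) ⊆ gridBox :=
  convex_gridBox.segment_subset (gridPoint_mem_gridBox (D.tail_mem_box k))
    (gridPoint_mem_gridBox (D.head_mem_box k))

theorem arc_injective (k : κ) : Function.Injective (D.arc k) := by
  have hdist : dist (gridPoint (D.tail k)) (gridPoint (D.head k)) < 1 :=
    dist_gridPoint_lt_one (D.short k).1 (D.short k).2
  intro s t hst
  refine Path.segment_injective_of_ne (gridPoint_injective.ne (D.ne k))
    (eq_of_torusProj_eq_of_dist_lt_one hst ?_)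
  rw [Path.segment_apply, Path.segment_apply, dist_lineMap_lineMap]
  exact (mul_le_of_le_one_left dist_nonneg (Real.dist_le_of_mem_Icc_01 s.2 t.2)).trans_lt hdist

theorem disjoint_openArc_range {k l : κ} (hkl : k ≠ l) :
    Disjoint (openArc (D.arc k)) (range (D.arc l)) := by
  rw [openArc_arc, range_arc]
  refine disjoint_image_torusProj
    ((openSegment_subset_segment ℝ _ _).trans (D.segment_subset_gridBox k))
    (D.segment_subset_gridBox l) fun s hs => ?_
  rw [vadd_segment, vadd_eq_add, vadd_eq_add, ← gridPoint_add, ← gridPoint_add]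
  exact (D.apart k l hkl s hs).disjoint

/-- A lift to the plane of a face of the drawing that is a convex polygon, with corners in
`(1 / 8) ℤ²`. Its `i`-th side is a translate of the lift of the edge `side i`, and every translate
of the lift of an edge, and of the polygon itself, lies on the outer side of the line through some
side of the polygon. -/
structure LiftedFace (n : ℕ) [NeZero n] where
  corner : Fin n → ℤ × ℤ
  side : Fin n → κ
  corner_mem_box : ∀ i, corner i ∈ Icc (-4, -4) (12, 12)
  isConvexPolygon : IsConvexPolygon corner
  side_eq : ∀ i, ∃ s ∈ boxPeriods, s(corner i, corner (i + 1)) =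
    s(8 • s + D.tail (side i), 8 • s + D.head (side i))
  avoid : ∀ k, ∀ s ∈ boxPeriods, ∃ i,
    signedArea (corner i) (corner (i + 1)) (8 • s + D.tail k) ≤ 0 ∧
    signedArea (corner i) (corner (i + 1)) (8 • s + D.head k) ≤ 0
  avoid_self : ∀ s ∈ boxPeriods, s ≠ 0 → ∃ i, ∀ j,
    signedArea (corner i) (corner (i + 1)) (8 • s + corner j) ≤ 0

namespace LiftedFace

variable {D} {n : ℕ} [NeZero n] (F : D.LiftedFace n)

/-- The open polygon in the plane that is spanned by the corners. -/
def interior : Set (ℝ × ℝ) := openPolygon (gridPoint ∘ F.corner)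

theorem isConvexPolygon_gridPoint : IsConvexPolygon (gridPoint ∘ F.corner) := by
  refine ⟨F.isConvexPolygon.1, fun i j hj hj' => ?_⟩
  rw [Function.comp_apply, Function.comp_apply, Function.comp_apply, signedArea_gridPoint]
  exact div_pos (Int.cast_pos.2 (F.isConvexPolygon.2 i j hj hj')) (by norm_num)

theorem convexHull_subset_gridBox : convexHull ℝ (range (gridPoint ∘ F.corner)) ⊆ gridBox := by
  refine convexHull_min ?_ convex_gridBox
  rintro _ ⟨i, rfl⟩
  exact gridPoint_mem_gridBox (F.corner_mem_box i)

theorem closure_interior_subset :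
    closure F.interior ⊆ convexHull ℝ (range (gridPoint ∘ F.corner)) :=
  F.isConvexPolygon_gridPoint.closure_openPolygon_subset

theorem interior_subset_gridBox : F.interior ⊆ gridBox :=
  subset_closure.trans (F.closure_interior_subset.trans F.convexHull_subset_gridBox)

theorem disjoint_image_interior_image : Disjoint (torusProj '' F.interior) D.image := by
  refine disjoint_iUnion_right.2 fun k => ?_
  rw [range_arc]
  refine disjoint_image_torusProj F.interior_subset_gridBox (D.segment_subset_gridBox k)
    fun s hs => ?_
  obtain ⟨i, ht, hh⟩ := F.avoid k s hs
  rw [vadd_segment, vadd_eq_add, vadd_eq_add, ← gridPoint_add, ← gridPoint_add, ← convexHull_pair]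
  refine disjoint_openPolygon_convexHull i ?_
  rintro _ (rfl | rfl)
  · exact signedArea_gridPoint_nonpos ht
  · exact signedArea_gridPoint_nonpos hh

theorem injOn_interior : InjOn torusProj F.interior := by
  refine injOn_torusProj F.interior_subset_gridBox fun s hs hs0 => ?_
  obtain ⟨i, hi⟩ := F.avoid_self s hs hs0
  have hsub : F.interior ⊆ convexHull ℝ (range (gridPoint ∘ F.corner)) :=
    subset_closure.trans F.closure_interior_subset
  refine Disjoint.mono_right (vadd_set_mono hsub) ?_
  rw [← convexHull_vadd]
  refine disjoint_openPolygon_convexHull i ?_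
  rintro _ ⟨_, ⟨j, rfl⟩, rfl⟩
  dsimp only [vadd_eq_add, Function.comp_apply]
  rw [← gridPoint_add]
  exact signedArea_gridPoint_nonpos (hi j)

theorem range_arc_side (i : Fin n) : range (D.arc (F.side i)) =
    torusProj '' segment ℝ (gridPoint (F.corner i)) (gridPoint (F.corner (i + 1))) := by
  obtain ⟨s, -, hs⟩ := F.side_eq i
  have hseg : segment ℝ (gridPoint (F.corner i)) (gridPoint (F.corner (i + 1))) =
      gridPoint (8 • s) +ᵥ
        segment ℝ (gridPoint (D.tail (F.side i))) (gridPoint (D.head (F.side i))) := by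
    rw [vadd_segment, vadd_eq_add, vadd_eq_add, ← gridPoint_add, ← gridPoint_add]
    obtain ⟨h₁, h₂⟩ | ⟨h₁, h₂⟩ := Sym2.eq_iff.1 hs
    · rw [h₁, h₂]
    · rw [h₁, h₂, segment_symm]
  rw [hseg, range_arc, ← image_vadd, image_image]
  simp only [torusProj_vadd]

theorem frontier_image_interior :
    frontier (torusProj '' F.interior) = ⋃ i, range (D.arc (F.side i)) := by
  have hcompact : IsCompact (closure F.interior) :=
    ((finite_range _).isCompact_convexHull ℝ).of_isClosed_subset isClosed_closure
      F.closure_interior_subset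
  have hdisj : Disjoint (⋃ i, range (D.arc (F.side i))) (torusProj '' F.interior) :=
    F.disjoint_image_interior_image.symm.mono_left
      (iUnion_subset fun i => subset_iUnion (fun k => range (D.arc k)) (F.side i))
  have hclosure : closure F.interior = F.interior ∪ frontier F.interior :=
    closure_eq_self_union_frontier _
  rw [(isOpenMap_torusProj F.interior isOpen_openPolygon).frontier_eq,
    ← image_closure_of_isCompact hcompact continuous_torusProj.continuousOn, hclosure, image_union,
    union_sdiff_left, interior, F.isConvexPolygon_gridPoint.frontier_openPolygon, image_iUnion]
  simp only [Function.comp_apply, ← range_arc_side]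
  exact hdisj.sdiff_eq_left

theorem openArc_arc_side_subset (i : Fin n) :
    openArc (D.arc (F.side i)) ⊆ torusProj '' closure F.interior := by
  refine (image_subset_range _ _).trans ?_
  rw [range_arc_side]
  exact image_mono (F.isConvexPolygon_gridPoint.segment_subset_closure_openPolygon i)

variable {α β : Type*} {G : Graph α β} {φ : G.SpaceEmbedding (UnitAddTorus (Fin 2))}

theorem isConvexRegion (hφ : φ.image = D.image) : φ.IsConvexRegion torusProj F.interior where
  continuous := continuous_torusProj
  isOpen := isOpen_openPolygon
  nonempty := F.isConvexPolygon_gridPoint.openPolygon_nonempty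
  convex := convex_openPolygon
  injOn := F.injOn_interior
  disjoint := hφ ▸ F.disjoint_image_interior_image

theorem isFace (hφ : φ.image = D.image) : φ.IsFace (torusProj '' F.interior) := by
  refine (F.isConvexRegion hφ).isFace isOpenMap_torusProj ?_
  rw [hφ, frontier_image_interior]
  exact iUnion_subset fun i => subset_iUnion (fun k => range (D.arc k)) (F.side i)

theorem hasChord (hφ : φ.image = D.image) {e f : β} (he : e ∈ G.edgeSet) (hf : f ∈ G.edgeSet)
    {i j : Fin n} (hei : φ.arc e = D.arc (F.side i)) (hfj : φ.arc f = D.arc (F.side j)) :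
    φ.HasChord e f :=
  (F.isConvexRegion hφ).hasChord one_lt_rank_real_prod (hei ▸ F.openArc_arc_side_subset i)
    (hfj ▸ F.openArc_arc_side_subset j) he hf

theorem hasLollipop (hφ : φ.image = D.image) {e : β} (he : e ∈ G.edgeSet) {i : Fin n}
    (hei : φ.arc e = D.arc (F.side i)) : φ.HasLollipop e :=
  (F.isConvexRegion hφ).hasLollipop one_lt_rank_real_prod (hei ▸ F.openArc_arc_side_subset i) he

end LiftedFace

end TorusDrawing

theorem Graph.IsCycleOn.girth_le {α β : Type*} {G : Graph α β} {n : ℕ} {v : ZMod n → α}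
    {e : ZMod n → β} (h : G.IsCycleOn n v e) : G.girth ≤ n :=
  sInf_le ⟨n, v, e, h, rfl⟩

namespace Graph.EdgeAddition

variable {α β : Type*} {G : Graph α β}

theorem girth_lollipop_le {e : β} {x y : α} (h : G.IsLink e x y) :
    (G.addEdge (.lollipop e x y h)).girth ≤ 1 := by
  refine (IsCycleOn.girth_le (n := 1) (v := fun _ => .inr 1) (e := fun _ => .inr 3)
    ⟨one_pos, ?_, ?_, fun _ => rfl⟩).trans (by simp)
  · exact fun i j _ => Subsingleton.elim i j
  · exact fun i j _ => Subsingleton.elim i j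

theorem girth_parallel_le {e : β} {x y : α} (h : G.IsLink e x y) :
    (G.addEdge (.parallel e x y h)).girth ≤ 2 := by
  refine (IsCycleOn.girth_le (n := 2) (v := (![.inr 0, .inr 1] : Fin 2 → _))
    (e := (![.inr 1, .inr 3] : Fin 2 → _)) ⟨two_pos, ?_, ?_, ?_⟩).trans (by simp)
  · intro i j hij
    fin_cases i <;> fin_cases j <;> first | rfl | simp at hij
  · intro i j hij
    fin_cases i <;> fin_cases j <;> first | rfl | simp at hij
  · intro i
    fin_cases i
    · rfl
    · exact congrArg some Sym2.eq_swap

theorem girth_join_le {e₁ e₂ : β} {x₁ y₁ x₂ y₂ : α}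
    (h₁ : G.IsLink e₁ x₁ y₁) (h₂ : G.IsLink e₂ x₂ y₂) (hne : e₁ ≠ e₂) {w : α}
    (hw₁ : w = x₁ ∨ w = y₁) (hw₂ : w = x₂ ∨ w = y₂) :
    (G.addEdge (.join e₁ x₁ y₁ h₁ e₂ x₂ y₂ h₂ hne)).girth ≤ 3 := by
  set c : G.EdgeAddition := .join e₁ x₁ y₁ h₁ e₂ x₂ y₂ h₂ hne
  obtain ⟨i, hi, hi'⟩ : ∃ i < 2, c.newEnds[i]? = some s(.inl w, .inr 0) := by
    rcases hw₁ with rfl | rfl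
    · exact ⟨0, by norm_num, rfl⟩
    · exact ⟨1, by norm_num, congrArg some Sym2.eq_swap⟩
  obtain ⟨j, hj, hj', hj''⟩ : ∃ j, 2 ≤ j ∧ j < 4 ∧ c.newEnds[j]? = some s(.inr 1, .inl w) := by
    rcases hw₂ with rfl | rfl
    · exact ⟨2, by norm_num, by norm_num, congrArg some Sym2.eq_swap⟩
    · exact ⟨3, by norm_num, by norm_num, rfl⟩
  refine (IsCycleOn.girth_le (n := 3) (v := (![.inl w, .inr 0, .inr 1] : Fin 3 → _))
    (e := (![.inr i, .inr 4, .inr j] : Fin 3 → _)) ⟨three_pos, ?_, ?_, ?_⟩).trans (by simp)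
  · intro k l hkl
    fin_cases k <;> fin_cases l <;> first | rfl | simp at hkl
  · intro k l hkl
    fin_cases k <;> fin_cases l <;> first | rfl | (simp at hkl; omega)
  · intro k
    fin_cases k
    exacts [hi', rfl, hj'']

end Graph.EdgeAddition

namespace Graph.SpaceEmbedding

variable {α X : Type*} [TopologicalSpace X] {H : SimpleGraph α}

/-- The embedding `φ` of a simple graph, precomposed with the automorphism `τ`. -/
def relabel (φ : (ofSimpleGraph H).SpaceEmbedding X) (τ : H ≃g H) :
    (ofSimpleGraph H).SpaceEmbedding X where
  vert x := φ.vert (τ x)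
  arc e := φ.arc (e.map τ)
  vert_injOn _ _ _ _ h := τ.injective (φ.vert_injOn trivial trivial h)
  arc_ends e he := by
    induction e with | h a b => ?_
    obtain ⟨x, y, h, h0, h1⟩ := φ.arc_ends _ (τ.map_mem_edgeSet_iff.2 he)
    refine ⟨τ.symm x, τ.symm y, ⟨?_, he⟩, by simpa using h0, by simpa using h1⟩
    simpa using congrArg (Sym2.map τ.symm) h.1
  arc_injOn e he := φ.arc_injOn _ (τ.map_mem_edgeSet_iff.2 he)
  arc_ne_vert e he t ht _ _ := φ.arc_ne_vert _ (τ.map_mem_edgeSet_iff.2 he) t ht _ trivial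
  arc_disjoint e he f hf hne :=
    φ.arc_disjoint _ (τ.map_mem_edgeSet_iff.2 he) _ (τ.map_mem_edgeSet_iff.2 hf)
      fun h => hne (Sym2.map.injective τ.injective h)

theorem compl_image_subset_relabel (φ : (ofSimpleGraph H).SpaceEmbedding X) (τ : H ≃g H) :
    φ.imageᶜ ⊆ (φ.relabel τ).imageᶜ := by
  refine compl_subset_compl.2 (union_subset ?_ (iUnion₂_subset fun e he => ?_))
  · rintro _ ⟨x, -, rfl⟩
    exact .inl ⟨τ x, trivial, rfl⟩
  · exact fun z hz => .inr (mem_biUnion (x := e.map τ) (τ.map_mem_edgeSet_iff.2 he) hz)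

theorem HasChord.relabel {φ : (ofSimpleGraph H).SpaceEmbedding X} {τ : H ≃g H} {e f : Sym2 α}
    (h : φ.HasChord (e.map τ) (f.map τ)) : (φ.relabel τ).HasChord e f := by
  obtain ⟨p, hp, q, hq, hpq, γ, hγ⟩ := h
  exact ⟨p, hp, q, hq, hpq, γ, hγ.mono (φ.compl_image_subset_relabel τ)⟩

theorem HasLollipop.relabel {φ : (ofSimpleGraph H).SpaceEmbedding X} {τ : H ≃g H} {e : Sym2 α}
    (h : φ.HasLollipop (e.map τ)) : (φ.relabel τ).HasLollipop e := by
  obtain ⟨p, hp, q, hq, γ, l, hγ, hl, hγl⟩ := h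
  have hsub := φ.compl_image_subset_relabel τ
  exact ⟨p, hp, q, hsub hq, γ, l, hγ.mono (sdiff_subset_sdiff_left hsub),
    hl.mono (sdiff_subset_sdiff_left hsub), hγl⟩

end Graph.SpaceEmbedding

namespace F14

open F14Vertex

instance : Fintype F14Vertex where
  elems := {A, Ap, B, Bp, n1, n2, n3, n4, n5, n6, n7, n8}
  complete x := by cases x <;> decide

/-- The ends of the edges of `F₁₄`. -/
def ends : Fin 18 → F14Vertex × F14Vertex :=
  ![(A, Ap), (B, Bp), (A, n1), (A, n5), (Ap, n3), (Ap, n7), (B, n2), (B, n6), (Bp, n4), (Bp, n8),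
    (n1, n2), (n2, n3), (n3, n4), (n4, n5), (n5, n6), (n6, n7), (n7, n8), (n8, n1)]

/-- The edges of `F₁₄`. -/
def edge (k : Fin 18) : Sym2 F14Vertex := s((ends k).1, (ends k).2)

theorem edge_injective : Function.Injective edge := by decide +kernel

theorem mem_edgeSet {e : Sym2 F14Vertex} : e ∈ F14.edgeSet ↔ ∃ k, edge k = e := by
  have hdiag : ∀ k, ¬ (edge k).IsDiag := by decide +kernel
  have hrange : e ∈ range edge ↔ e ∈ ({s(A, Ap), s(B, Bp),
      s(A, n1), s(A, n5), s(Ap, n3), s(Ap, n7), s(B, n2), s(B, n6), s(Bp, n4), s(Bp, n8),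
      s(n1, n2), s(n2, n3), s(n3, n4), s(n4, n5), s(n5, n6), s(n6, n7), s(n7, n8), s(n8, n1)} :
        Set (Sym2 F14Vertex)) := by
    simp [edge, ends, Fin.exists_fin_succ, eq_comm]
  rw [F14, SimpleGraph.edgeSet_fromEdgeSet, mem_sdiff, ← hrange]
  constructor
  · rintro ⟨⟨k, hk⟩, -⟩
    exact ⟨k, hk⟩
  · rintro ⟨k, rfl⟩
    exact ⟨⟨k, rfl⟩, hdiag k⟩

theorem adj_iff {x y : F14Vertex} : F14.Adj x y ↔ ∃ k, edge k = s(x, y) := by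
  rw [← SimpleGraph.mem_edgeSet, mem_edgeSet]

instance : DecidableRel F14.Adj := fun _ _ => decidable_of_iff _ adj_iff.symm

/-- The points of the grid at which the vertices of `F₁₄` are drawn on the torus `ℝ² / 8 ℤ²`. -/
def position : F14Vertex → ℤ × ℤ
  | A => (1, 1) | Ap => (3, 6) | B => (4, 3) | Bp => (5, 0)
  | n1 => (6, 5) | n2 => (5, 5) | n3 => (4, 6) | n4 => (4, 0)
  | n5 => (3, 1) | n6 => (2, 4) | n7 => (1, 5) | n8 => (6, 7)

/-- The edge `k` is drawn as the straight segment to the translate by the period `8 • winding k` of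
the position of its second end. -/
def winding : Fin 18 → ℤ × ℤ :=
  ![(0, -1), 0, (-1, 0), 0, 0, 0, 0, 0, 0, (0, -1), 0, 0, (0, 1), 0, 0, 0, (-1, 0), 0]

/-- A drawing of `F₁₄` on the torus. -/
def drawing : TorusDrawing (Fin 18) where
  tail k := position (ends k).1
  head k := 8 • winding k + position (ends k).2
  tail_mem_box := by decide +kernel
  head_mem_box := by decide +kernel
  ne := by decide +kernel
  short := by decide +kernel
  apart := by decide +kernel

theorem arc_zero (k : Fin 18) :
    drawing.arc k 0 = torusProj (gridPoint (position (ends k).1)) := by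
  simp [TorusDrawing.arc, drawing]

theorem arc_one (k : Fin 18) :
    drawing.arc k 1 = torusProj (gridPoint (position (ends k).2)) := by
  have h : drawing.arc k 1 = torusProj (gridPoint (drawing.head k)) := by simp [TorusDrawing.arc]
  rw [h]
  exact torusProj_gridPoint_eq_iff.2 ⟨winding k, rfl⟩

theorem exists_position_mem_range_arc (x : F14Vertex) (k : Fin 18) :
    ∃ l ≠ k, torusProj (gridPoint (position x)) ∈ range (drawing.arc l) := by
  have hdeg : ∀ x k, ∃ l, l ≠ k ∧ (x = (ends l).1 ∨ x = (ends l).2) := by decide +kernel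
  obtain ⟨l, hl, rfl | rfl⟩ := hdeg x k
  · exact ⟨l, hl, 0, arc_zero l⟩
  · exact ⟨l, hl, 1, arc_one l⟩

theorem injective_torusProj_position :
    Function.Injective fun x => torusProj (gridPoint (position x)) := by
  have hmod : ∀ x y, (8 : ℤ) ∣ (position x).1 - (position y).1 →
      (8 : ℤ) ∣ (position x).2 - (position y).2 → x = y := by decide +kernel
  intro x y hxy
  obtain ⟨s, hs⟩ := torusProj_gridPoint_eq_iff.1 hxy
  refine hmod x y ⟨s.1, ?_⟩ ⟨s.2, ?_⟩ <;> simp [hs]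

theorem invFun_edge (k : Fin 18) : Function.invFun edge (edge k) = k :=
  Function.leftInverse_invFun edge_injective k

/-- The embedding of `F₁₄` into the torus that is given by the drawing. -/
noncomputable def embedding : F14Graph.SpaceEmbedding (UnitAddTorus (Fin 2)) where
  vert x := torusProj (gridPoint (position x))
  arc e := drawing.arc (Function.invFun edge e)
  vert_injOn := injective_torusProj_position.injOn
  arc_ends e he := by
    obtain ⟨k, rfl⟩ := mem_edgeSet.1 he
    rw [invFun_edge]
    exact ⟨_, _, ⟨rfl, he⟩, arc_zero k, arc_one k⟩
  arc_injOn e _ := (drawing.arc_injective _).injOn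
  arc_ne_vert e _ t ht x _ h := by
    obtain ⟨l, hl, hx⟩ := exists_position_mem_range_arc x (Function.invFun edge e)
    exact disjoint_left.1 (drawing.disjoint_openArc_range hl.symm) (mem_image_of_mem _ ht) (h ▸ hx)
  arc_disjoint e he f hf hne s hs t _ h := by
    obtain ⟨k, rfl⟩ := mem_edgeSet.1 he
    obtain ⟨l, rfl⟩ := mem_edgeSet.1 hf
    rw [invFun_edge, invFun_edge] at h
    exact disjoint_left.1 (drawing.disjoint_openArc_range (ne_of_apply_ne edge hne))
      (mem_image_of_mem _ hs) (h ▸ mem_range_self t)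

theorem embedding_arc (k : Fin 18) : embedding.arc (edge k) = drawing.arc k :=
  congrArg drawing.arc (invFun_edge k)

theorem edge_mem_edgeSet (k : Fin 18) : edge k ∈ F14Graph.edgeSet := mem_edgeSet.2 ⟨k, rfl⟩

theorem embedding_image : embedding.image = drawing.image := by
  apply subset_antisymm
  · refine union_subset ?_ (iUnion₂_subset fun e _ => subset_iUnion_of_subset _ subset_rfl)
    rintro _ ⟨x, -, rfl⟩
    obtain ⟨l, -, hx⟩ := exists_position_mem_range_arc x 0
    exact mem_iUnion.2 ⟨l, hx⟩
  · refine iUnion_subset fun k z hz => .inr (mem_biUnion (edge_mem_edgeSet k) ?_)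
    rwa [embedding_arc]

/-- The face `A 1 2 B B' 8 7 A'` of the drawing. -/
def octagon : drawing.LiftedFace 8 where
  corner := ![(1, 1), (-2, 5), (-3, 5), (-4, 3), (-3, 0), (-2, -1), (1, -3), (3, -2)]
  side := ![2, 10, 6, 1, 9, 16, 5, 0]
  corner_mem_box := by decide +kernel
  isConvexPolygon := ⟨by norm_num, by decide +kernel⟩
  side_eq := by decide +kernel
  avoid := by decide +kernel
  avoid_self := by decide +kernel

/-- The face `A 5 6 7 8 1` of the drawing. -/
def hexagonA : drawing.LiftedFace 6 where
  corner := ![(1, 1), (3, 1), (2, 4), (1, 5), (-2, 7), (-2, 5)]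
  side := ![3, 14, 15, 16, 17, 2]
  corner_mem_box := by decide +kernel
  isConvexPolygon := ⟨by norm_num, by decide +kernel⟩
  side_eq := by decide +kernel
  avoid := by decide +kernel
  avoid_self := by decide +kernel

/-- The face `A' 7 6 B 2 3` of the drawing. -/
def hexagonB : drawing.LiftedFace 6 where
  corner := ![(3, 6), (1, 5), (2, 4), (4, 3), (5, 5), (4, 6)]
  side := ![5, 15, 7, 6, 11, 4]
  corner_mem_box := by decide +kernel
  isConvexPolygon := ⟨by norm_num, by decide +kernel⟩
  side_eq := by decide +kernel
  avoid := by decide +kernel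
  avoid_self := by decide +kernel

theorem hasFacialCycle_embedding : embedding.HasFacialCycle 8 := by
  let v : Fin 8 → F14Vertex := ![A, n1, n2, B, Bp, n8, n7, Ap]
  have hv : Function.Injective v := by decide +kernel
  have hside : Function.Injective octagon.side := by decide +kernel
  have hends : ∀ i : Fin 8, edge (octagon.side i) = s(v i, v (i + 1)) := by decide +kernel
  refine ⟨torusProj '' octagon.interior, v, fun i : Fin 8 => edge (octagon.side i),
    octagon.isFace embedding_image,
    ⟨by norm_num, hv, edge_injective.comp hside, fun i => ⟨hends i, edge_mem_edgeSet _⟩⟩, ?_⟩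
  rw [octagon.frontier_image_interior]
  simp only [embedding_arc]
  rfl

/-- The automorphism that rotates the cycle `1 2 … 8`. -/
def rotation : F14 ≃g F14 where
  toFun
    | A => B | B => Ap | Ap => Bp | Bp => A | n1 => n2 | n2 => n3
    | n3 => n4 | n4 => n5 | n5 => n6 | n6 => n7 | n7 => n8 | n8 => n1
  invFun
    | B => A | Ap => B | Bp => Ap | A => Bp | n2 => n1 | n3 => n2
    | n4 => n3 | n5 => n4 | n6 => n5 | n7 => n6 | n8 => n7 | n1 => n8
  left_inv := by intro x; cases x <;> rfl
  right_inv := by intro x; cases x <;> rfl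
  map_rel_iff' := by decide +kernel

/-- The automorphism that reflects the cycle `1 2 … 8` and fixes `1` and `5`. -/
def reflection : F14 ≃g F14 where
  toFun
    | A => A | B => Bp | Ap => Ap | Bp => B | n1 => n1 | n2 => n8
    | n3 => n7 | n4 => n6 | n5 => n5 | n6 => n4 | n7 => n3 | n8 => n2
  invFun
    | A => A | B => Bp | Ap => Ap | Bp => B | n1 => n1 | n2 => n8
    | n3 => n7 | n4 => n6 | n5 => n5 | n6 => n4 | n7 => n3 | n8 => n2
  left_inv := by intro x; cases x <;> rfl
  right_inv := by intro x; cases x <;> rfl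
  map_rel_iff' := by decide +kernel

/-- The automorphisms of `F₁₄` that are generated by `rotation` and `reflection`. -/
def automorphism (a : Fin 8 × Fin 2) : F14 ≃g F14 := rotation ^ (a.1 : ℕ) * reflection ^ (a.2 : ℕ)

/-- The edge `e` of `F₁₄` is a side of the face `F` of the drawing. -/
def IsSide {n : ℕ} [NeZero n] (F : drawing.LiftedFace n) (e : Sym2 F14Vertex) : Prop :=
  ∃ i, edge (F.side i) = e

instance {n : ℕ} [NeZero n] (F : drawing.LiftedFace n) (e : Sym2 F14Vertex) :
    Decidable (IsSide F e) := by
  unfold IsSide; infer_instance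

theorem IsSide.hasChord {n : ℕ} [NeZero n] {F : drawing.LiftedFace n} {e f : Sym2 F14Vertex}
    (he : IsSide F e) (hf : IsSide F f) : embedding.HasChord e f := by
  obtain ⟨i, rfl⟩ := he
  obtain ⟨j, rfl⟩ := hf
  exact F.hasChord embedding_image (edge_mem_edgeSet _) (edge_mem_edgeSet _) (embedding_arc _)
    (embedding_arc _)

theorem IsSide.hasLollipop {n : ℕ} [NeZero n] {F : drawing.LiftedFace n} {e : Sym2 F14Vertex}
    (he : IsSide F e) : embedding.HasLollipop e := by
  obtain ⟨i, rfl⟩ := he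
  exact F.hasLollipop embedding_image (edge_mem_edgeSet _) (embedding_arc _)

theorem exists_automorphism_isSide : ∀ k l, ∃ a,
    (IsSide octagon ((edge k).map (automorphism a)) ∧
      IsSide octagon ((edge l).map (automorphism a))) ∨
    (IsSide hexagonA ((edge k).map (automorphism a)) ∧
      IsSide hexagonA ((edge l).map (automorphism a))) ∨
    (IsSide hexagonB ((edge k).map (automorphism a)) ∧
      IsSide hexagonB ((edge l).map (automorphism a))) := by
  decide +kernel

theorem exists_hasChord_hasLollipop {e f : Sym2 F14Vertex} (he : e ∈ F14.edgeSet)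
    (hf : f ∈ F14.edgeSet) :
    ∃ τ : F14 ≃g F14, embedding.HasChord (e.map τ) (f.map τ) ∧ embedding.HasLollipop (e.map τ) := by
  obtain ⟨k, rfl⟩ := mem_edgeSet.1 he
  obtain ⟨l, rfl⟩ := mem_edgeSet.1 hf
  obtain ⟨a, ⟨hk, hl⟩ | ⟨hk, hl⟩ | ⟨hk, hl⟩⟩ := exists_automorphism_isSide k l
  all_goals exact ⟨automorphism a, hk.hasChord hl, hk.hasLollipop⟩

theorem isToroidal_addEdge (c : F14Graph.EdgeAddition) : (F14Graph.addEdge c).IsToroidal := by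
  cases c with
  | lollipop e x y h =>
    obtain ⟨τ, -, hτ⟩ := exists_hasChord_hasLollipop h.2 h.2
    exact (Graph.SpaceEmbedding.nonempty_addedArcs_lollipop h hτ.relabel).map (·.toSpaceEmbedding)
  | parallel e x y h =>
    obtain ⟨τ, hτ, -⟩ := exists_hasChord_hasLollipop h.2 h.2
    exact (Graph.SpaceEmbedding.nonempty_addedArcs_parallel h hτ.relabel).map (·.toSpaceEmbedding)
  | join e₁ x₁ y₁ h₁ e₂ x₂ y₂ h₂ hne =>
    obtain ⟨τ, hτ, -⟩ := exists_hasChord_hasLollipop h₁.2 h₂.2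
    obtain ⟨ψ, -⟩ := Graph.SpaceEmbedding.exists_extends_join h₁ h₂ hne hτ.relabel
    exact ⟨ψ⟩

theorem exists_automorphism_mem_cases : ∀ k l, (∀ x ∈ edge k, x ∉ edge l) →
    ∃ p ∈ F14Cases, ∃ a, (edge k = p.1.map (automorphism a) ∧ edge l = p.2.map (automorphism a)) ∨
      (edge k = p.2.map (automorphism a) ∧ edge l = p.1.map (automorphism a)) := by
  decide +kernel

theorem joins_of_four_le_girth (c : F14Graph.EdgeAddition)
    (hc : 4 ≤ (F14Graph.addEdge c).girth) :
    ∃ p ∈ F14Cases, ∃ σ : F14 ≃g F14, c.Joins (p.1.map σ) (p.2.map σ) := by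
  cases c with
  | lollipop e x y h =>
    exact absurd (hc.trans (Graph.EdgeAddition.girth_lollipop_le h)) (by decide)
  | parallel e x y h =>
    exact absurd (hc.trans (Graph.EdgeAddition.girth_parallel_le h)) (by decide)
  | join e₁ x₁ y₁ h₁ e₂ x₂ y₂ h₂ hne =>
    have hdisj : ∀ x ∈ e₁, x ∉ e₂ := by
      intro w hw₁ hw₂
      rw [h₁.1, Sym2.mem_iff] at hw₁
      rw [h₂.1, Sym2.mem_iff] at hw₂
      exact absurd (hc.trans (Graph.EdgeAddition.girth_join_le h₁ h₂ hne hw₁ hw₂)) (by decide)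
    obtain ⟨k, hk⟩ := mem_edgeSet.1 h₁.2
    obtain ⟨l, hl⟩ := mem_edgeSet.1 h₂.2
    obtain ⟨p, hp, a, h⟩ := exists_automorphism_mem_cases k l (hk.symm ▸ hl.symm ▸ hdisj)
    rw [hk, hl] at h
    exact ⟨p, hp, automorphism a, h⟩

theorem cases_mem_edgeSet {p : Sym2 F14Vertex × Sym2 F14Vertex} (hp : p ∈ F14Cases) :
    p.1 ∈ F14.edgeSet ∧ p.2 ∈ F14.edgeSet ∧ p.1 ≠ p.2 := by
  have h : F14Cases.all fun p => (∃ k, edge k = p.1) ∧ (∃ l, edge l = p.2) ∧ p.1 ≠ p.2 := by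
    decide +kernel
  simpa only [mem_edgeSet] using of_decide_eq_true (List.all_eq_true.1 h p hp)

theorem exists_extends_embedding {p : Sym2 F14Vertex × Sym2 F14Vertex} (hp : p ∈ F14Cases) :
    ∃ (σ : F14 ≃g F14) (c : F14Graph.EdgeAddition), c.Joins (p.1.map σ) (p.2.map σ) ∧
      ∃ ψ : (F14Graph.addEdge c).SpaceEmbedding (UnitAddTorus (Fin 2)), ψ.Extends embedding := by
  obtain ⟨h₁, h₂, hne⟩ := cases_mem_edgeSet hp
  obtain ⟨τ, hτ, -⟩ := exists_hasChord_hasLollipop h₁ h₂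
  have hne' : p.1.map τ ≠ p.2.map τ := (Sym2.map.injective τ.injective).ne hne
  have m₁ : p.1.map τ ∈ F14Graph.edgeSet := τ.map_mem_edgeSet_iff.2 h₁
  have m₂ : p.2.map τ ∈ F14Graph.edgeSet := τ.map_mem_edgeSet_iff.2 h₂
  obtain ⟨x₁, y₁, l₁⟩ := (F14Graph.edge_mem_iff_exists_isLink _).1 m₁
  obtain ⟨x₂, y₂, l₂⟩ := (F14Graph.edge_mem_iff_exists_isLink _).1 m₂
  exact ⟨τ, .join _ x₁ y₁ l₁ _ x₂ y₂ l₂ hne', .inl ⟨rfl, rfl⟩,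
    Graph.SpaceEmbedding.exists_extends_join l₁ l₂ hne' hτ⟩

end F14

theorem mainTheorem9 :
    (∀ c : F14Graph.EdgeAddition, (F14Graph.addEdge c).IsToroidal) ∧
    (∀ c : F14Graph.EdgeAddition, 4 ≤ (F14Graph.addEdge c).girth →
      ∃ p ∈ F14Cases, ∃ σ : F14 ≃g F14, c.Joins (p.1.map σ) (p.2.map σ)) ∧
    (∃ φ : F14Graph.SpaceEmbedding (UnitAddTorus (Fin 2)), φ.HasFacialCycle 8 ∧
      ∀ p ∈ F14Cases, ∃ (σ : F14 ≃g F14) (c : F14Graph.EdgeAddition),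
        c.Joins (p.1.map σ) (p.2.map σ) ∧
        ∃ ψ : (F14Graph.addEdge c).SpaceEmbedding (UnitAddTorus (Fin 2)), ψ.Extends φ) :=
  ⟨F14.isToroidal_addEdge, F14.joins_of_four_le_girth, F14.embedding,
    F14.hasFacialCycle_embedding, fun _ hp => F14.exists_extends_embedding hp⟩
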